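/- Setting. There are $n$ sellers and $w$ is an integer with $0<w<n$. Seller $i$ has a private cost $v_i$ and utility $p_i-x_iv_i$, where $x_i\in\{0,1\}$ indicates whether his data is bought and $p_i$ is his payment (costs and payments are measured in units of the privacy parameter $\epsilon$). The costs are drawn independently from a distribution with distribution function $F$. The distribution has range $[a,b]\subseteq[0,\infty)$ and a density $f$ that is piecewise continuous and positive on $[a,b]$; hence $F^{-1}:[0,1]\to[a,b]$ exists. Ironing. Let $\phi(z)=z+F(z)/f(z)$ and $H(q)=\int_0^q\phi(F^{-1}(t))\,dt$ for $q\in[0,1]$. Let $G$ be the convex hull of $H$, i.e. $G(q)$ is the smallest $y$ with $(q,y)$ in the convex hull of the epigraph of $H$. Let $g$ be the derivative of $G$ extended by right-continuity (the right derivative of $G$, with $g(1)=+\infty$). The ironed virtual cost is $\bar\phi(z)=g(F(z))$. The ironed intervals are $[F^{-1}(y),F^{-1}(z))$, where $(y,z)$ runs through the maximal open intervals that make up $\{q\in[0,1]: H(q)\ne G(q)\}$. Mechanisms. A BIC $w$-unit procurement mechanism is a randomized direct mechanism that always buys from exactly $w$ sellers, in which reporting the true cost maximizes a seller's expected utility when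 the other sellers' costs are drawn from $F$ and reported truthfully. A seller may also report $\infty$, in which case nothing is bought from him and he is paid nothing. All expected payments are assumed to exist. Let $M$ be the mechanism that buys from the $w$ sellers with the smallest ironed virtual costs, breaking ties uniformly at random, with expected payments $v_i\bar x_i(v_i,v_{-i})+\int_{v_i}^\infty\bar x_i(t,v_{-i})\,dt$, where $\bar x_i(v)$ is the probability that $M$ buys from $i$ on the reports $v$. Mechanism 1 offers every seller the price $\alpha=F^{-1}(w/n)$. A seller accepts if and only if $v_i\le\alpha$, and is then paid $\alpha$ plus independent centred Laplace noise of some scale $s\ge 0$ (no noise if $s=0$); a seller who rejects is paid $0$. Theorem. (i) $M$ is a BIC $w$-unit procurement mechanism, truthful for all real costs, and its expected purchase probability and expected payment for a seller tend to $0$ as his report tends to $\infty$. (ii) The expected total payment of $M$ is at most that of every $w$-unit procurement mechanism that is BIC for costs in $[a,b]$. (iii) Let $r>1$. If every ironed interval $[l,u)$ of $F$ satisfies $l\ge u/r$, then for every noise scale $s\ge 0$ the expected total payment of Mechanism 1 is at most $2r$ times the expected total payment of $M$. -/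

import Mathlib

open MeasureTheory Filter Topology

noncomputable section

namespace Procurement

/-! ### Cost distributions -/

/-- `f` is piecewise continuous on `[a, b]`: it is continuous off a finite set and has finite
one-sided limits at every point of `[a, b]` (from within `[a, b]`). -/
structure PiecewiseContinuous (f : ℝ → ℝ) (a b : ℝ) : Prop where
  continuousOn : ∃ D : Set ℝ, D.Finite ∧ ContinuousOn f (Set.Icc a b \ D)
  left_limit : ∀ c ∈ Set.Icc a b, ∃ l, Tendsto f (𝓝[Set.Icc a b ∩ Set.Iio c] c) (𝓝 l)
  right_limit : ∀ c ∈ Set.Icc a b, ∃ l, Tendsto f (𝓝[Set.Icc a b ∩ Set.Ioi c] c) (𝓝 l)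

/-- The cost law `μ` has range `[a, b] ⊆ [0, ∞)` and a density `f` that is piecewise continuous
and positive on `[a, b]`. -/
structure HasPositiveDensity (μ : Measure ℝ) (f : ℝ → ℝ) (a b : ℝ) : Prop where
  nonneg : 0 ≤ a
  lt : a < b
  eq_withDensity : μ = volume.withDensity (fun z => ENNReal.ofReal (f z))
  eq_zero : ∀ z, z ∉ Set.Icc a b → f z = 0
  pos : ∀ z ∈ Set.Icc a b, 0 < f z
  piecewise : PiecewiseContinuous f a b

/-- The inverse `F⁻¹ : [0, 1] → [a, b]` of the distribution function `F` of `μ`. -/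
def quantile (μ : Measure ℝ) (a b : ℝ) (q : ℝ) : ℝ :=
  Function.invFunOn (fun z => ProbabilityTheory.cdf μ z) (Set.Icc a b) q

/-! ### Virtual costs and ironing -/

/-- The virtual cost `φ(z) = z + F(z) / f(z)`. -/
def virtualCost (μ : Measure ℝ) (f : ℝ → ℝ) (z : ℝ) : ℝ :=
  z + ProbabilityTheory.cdf μ z / f z

/-- `H(q) = ∫₀^q h(t) dt` with `h(t) = φ(F⁻¹(t))`. -/
def cumulativeVirtualCost (μ : Measure ℝ) (f : ℝ → ℝ) (a b : ℝ) (q : ℝ) : ℝ :=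
  ∫ t in (0 : ℝ)..q, virtualCost μ f (quantile μ a b t)

/-- The convex hull of a function `H` on `[0, 1]`: the lower boundary of the convex hull of its
epigraph. -/
def lowerConvexHull (H : ℝ → ℝ) (q : ℝ) : ℝ :=
  sInf {y : ℝ | (q, y) ∈ convexHull ℝ {p : ℝ × ℝ | p.1 ∈ Set.Icc (0 : ℝ) 1 ∧ H p.1 ≤ p.2}}

/-- The convex hull `G` of `H`. -/
def ironedCumulative (μ : Measure ℝ) (f : ℝ → ℝ) (a b : ℝ) : ℝ → ℝ :=
  lowerConvexHull (cumulativeVirtualCost μ f a b)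

/-- The set `T` of the `q ∈ [0, 1]` with `H(q) ≠ G(q)`. -/
def ironedQuantiles (μ : Measure ℝ) (f : ℝ → ℝ) (a b : ℝ) : Set ℝ :=
  {q | q ∈ Set.Icc (0 : ℝ) 1 ∧ cumulativeVirtualCost μ f a b q ≠ ironedCumulative μ f a b q}

/-- `[l, u)` is an ironed interval: `l = F⁻¹(y)` and `u = F⁻¹(z)` for one of the maximal open
intervals `(y, z)` that make up `T`. -/
def IsIronedInterval (μ : Measure ℝ) (f : ℝ → ℝ) (a b : ℝ) (l u : ℝ) : Prop :=
  ∃ y z : ℝ, y < z ∧ Set.Ioo y z ⊆ ironedQuantiles μ f a b ∧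
    y ∉ ironedQuantiles μ f a b ∧ z ∉ ironedQuantiles μ f a b ∧
    l = quantile μ a b y ∧ u = quantile μ a b z

/-- The derivative `g` of the convex function `G`, extended by right-continuity, that is, the right
derivative of `G`. At the right end point `1` of the domain of `G` it is `+∞`, the usual convention
for a convex function on an interval. -/
def ironedSlope (μ : Measure ℝ) (f : ℝ → ℝ) (a b : ℝ) (q : ℝ) : EReal :=
  open Classical in
  if q < 1 then ((derivWithin (ironedCumulative μ f a b) (Set.Ioi q) q : ℝ) : EReal) else ⊤

/-- The ironed virtual cost `g(F(z))`. -/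
def ironedVirtualCost (μ : Measure ℝ) (f : ℝ → ℝ) (a b : ℝ) (z : ℝ) : EReal :=
  ironedSlope μ f a b (ProbabilityTheory.cdf μ z)

/-! ### Direct procurement mechanisms -/

/-- A randomized direct mechanism for `n` sellers: on a profile of reported costs it draws the set
of sellers it buys from according to `alloc`, and `pay v i` is the payment to seller `i` averaged
over the mechanism's own randomness. -/
structure DirectMechanism (n : ℕ) where
  alloc : (Fin n → ℝ) → PMF (Finset (Fin n))
  pay : (Fin n → ℝ) → Fin n → ℝ

namespace DirectMechanism

variable {n : ℕ}

/-- The probability that the mechanism buys from seller `i` on the report profile `v`. -/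
def buyProb (M : DirectMechanism n) (v : Fin n → ℝ) (i : Fin n) : ℝ :=
  ∑ W : Finset (Fin n), if i ∈ W then (M.alloc v W).toReal else 0

/-- Seller `i`'s probability of selling when he reports `t` and the others report costs drawn
independently from `μ`. -/
def interimBuyProb (M : DirectMechanism n) (μ : Measure ℝ) (i : Fin n) (t : ℝ) : ℝ :=
  ∫ v, M.buyProb (Function.update v i t) i ∂(Measure.pi fun _ : Fin n => μ)

/-- Seller `i`'s expected payment when he reports `t` and the others report costs drawn
independently from `μ`. -/
def interimPay (M : DirectMechanism n) (μ : Measure ℝ) (i : Fin n) (t : ℝ) : ℝ :=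
  ∫ v, M.pay (Function.update v i t) i ∂(Measure.pi fun _ : Fin n => μ)

/-- The expected utility of seller `i` with cost `c` who reports `t`. -/
def interimUtility (M : DirectMechanism n) (μ : Measure ℝ) (i : Fin n) (c t : ℝ) : ℝ :=
  M.interimPay μ i t - c * M.interimBuyProb μ i t

/-- The expected total payment when all costs are drawn independently from `μ` and reported
truthfully. -/
def expectedPayment (M : DirectMechanism n) (μ : Measure ℝ) : ℝ :=
  ∫ v, ∑ i, M.pay v i ∂(Measure.pi fun _ : Fin n => μ)

/-- `M` is a BIC `w`-unit procurement mechanism for sellers whose costs lie in `T`. The first four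
fields say that all expectations exist. The field `participation` is truthfulness against the
report `∞`, on which nothing is bought and nothing is paid. -/
structure IsBICProcurement (M : DirectMechanism n) (μ : Measure ℝ) (w : ℕ) (T : Set ℝ) :
    Prop where
  measurable_buyProb : ∀ i, Measurable fun v => M.buyProb v i
  measurable_pay : ∀ i, Measurable fun v => M.pay v i
  integrable_pay : ∀ i, Integrable (fun v => M.pay v i) (Measure.pi fun _ : Fin n => μ)
  integrable_interim : ∀ i t, Integrable (fun v => M.pay (Function.update v i t) i)
    (Measure.pi fun _ : Fin n => μ)
  buys : ∀ v : Fin n → ℝ, (∀ i, v i ∈ T) → ∀ W ∈ (M.alloc v).support, W.card = w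
  truthful : ∀ i, ∀ c ∈ T, ∀ t : ℝ, M.interimUtility μ i c t ≤ M.interimUtility μ i c c
  participation : ∀ i, ∀ c ∈ T, 0 ≤ M.interimUtility μ i c c

/-- No purchase and no payment in the limit of an infinite report. -/
def VanishesAtInfinity (M : DirectMechanism n) (μ : Measure ℝ) : Prop :=
  ∀ i, Tendsto (M.interimBuyProb μ i) atTop (𝓝 0) ∧ Tendsto (M.interimPay μ i) atTop (𝓝 0)

end DirectMechanism

/-! ### Buying at the lowest ironed virtual costs -/

/-- The sets of `w` sellers with the smallest scores. -/
def cheapestSets {n : ℕ} (w : ℕ) (s : Fin n → EReal) : Finset (Finset (Fin n)) :=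
  open Classical in
  {W : Finset (Fin n) | W.card = w ∧ ∀ i ∈ W, ∀ j ∉ W, s i ≤ s j}

theorem cheapestSets_nonempty {n : ℕ} (w : ℕ) (hw : w ≤ n) (s : Fin n → EReal) :
    (cheapestSets w s).Nonempty := by
  induction w with
  | zero => exact ⟨∅, by simp [cheapestSets]⟩
  | succ k ih =>
    obtain ⟨W, hW⟩ := ih (by omega)
    simp only [cheapestSets, Finset.mem_filter, Finset.mem_univ, true_and] at hW
    have hne : (Wᶜ : Finset (Fin n)).Nonempty := by
      rw [← Finset.card_pos, Finset.card_compl, Fintype.card_fin]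
      omega
    obtain ⟨j, hj, hmin⟩ := Finset.exists_min_image Wᶜ s hne
    rw [Finset.mem_compl] at hj
    refine ⟨insert j W, ?_⟩
    simp only [cheapestSets, Finset.mem_filter, Finset.mem_univ, true_and]
    refine ⟨by rw [Finset.card_insert_of_notMem hj, hW.1], fun i hi l hl => ?_⟩
    rw [Finset.mem_insert, not_or] at hl
    rcases Finset.mem_insert.1 hi with rfl | hi
    · exact hmin l (Finset.mem_compl.2 hl.2)
    · exact hW.2 i hi l hl.2

/-- The lottery that buys from the `w` sellers with the smallest ironed virtual costs and breaks
ties uniformly at random. -/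
def ironedAlloc (μ : Measure ℝ) (f : ℝ → ℝ) (a b : ℝ) {n w : ℕ} (hw : w ≤ n)
    (v : Fin n → ℝ) : PMF (Finset (Fin n)) :=
  PMF.uniformOfFinset (cheapestSets w fun i => ironedVirtualCost μ f a b (v i))
    (cheapestSets_nonempty w hw _)

/-- The probability `x_i(v)` that the lottery `ironedAlloc` buys from seller `i`. -/
def ironedBuyProb (μ : Measure ℝ) (f : ℝ → ℝ) (a b : ℝ) {n w : ℕ} (hw : w ≤ n)
    (v : Fin n → ℝ) (i : Fin n) : ℝ :=
  ∑ W : Finset (Fin n), if i ∈ W then (ironedAlloc μ f a b hw v W).toReal else 0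

/-- The `w`-unit mechanism that buys at the smallest ironed virtual costs with uniformly random tie
breaking, with expected payments `v_i x_i(v) + ∫_{v_i}^∞ x_i(t, v_{-i}) dt`. -/
def ironedMechanism (μ : Measure ℝ) (f : ℝ → ℝ) (a b : ℝ) {n w : ℕ} (hw : w ≤ n) :
    DirectMechanism n where
  alloc := ironedAlloc μ f a b hw
  pay v i := v i * ironedBuyProb μ f a b hw v i +
    ∫ t in Set.Ioi (v i), ironedBuyProb μ f a b hw (Function.update v i t) i

/-! ### The private posted-price mechanism -/

/-- The centred Laplace law with scale `s`; the point mass at `0` if `s = 0`. -/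
def laplaceLaw (s : ℝ) : Measure ℝ :=
  open Classical in
  if s = 0 then Measure.dirac 0
  else volume.withDensity fun x => ENNReal.ofReal (Real.exp (-|x| / s) / (2 * s))

/-- The expected total payment of the mechanism that offers every seller the price `α`: the sellers
with cost at most `α` accept, and a seller who accepts is paid `α` plus independent Laplace noise of
scale `s`. -/
def noisyPostedPricePayment (μ : Measure ℝ) (n : ℕ) (α s : ℝ) : ℝ :=
  ∫ ω : (Fin n → ℝ) × (Fin n → ℝ), ∑ i, (if ω.1 i ≤ α then α + ω.2 i else 0)
    ∂((Measure.pi fun _ : Fin n => μ).prod (Measure.pi fun _ : Fin n => laplaceLaw s))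

end Procurement

end

/-! This is Myerson's argument for procurement, carried out in quantile space with integrals and
right derivatives only, since the distribution function `F` need not be differentiable everywhere.
Fubini shows that a threshold rule `X`, with payment `z X(z) + ∫_z^b X`, costs `∫ X(z) (z f(z) +
F(z)) dz` in expectation (`integral_payment`). For the posted price `c` this gives `H(F(c)) = c
F(c)`, so `H(q) = q F⁻¹(q)`.

For (ii), an antitone `X` is sliced into its superlevel sets, which are initial segments `[a, c_y]`
up to null sets. Hence the threshold payment exceeds the expected ironed virtual cost by `∫₀¹ (H -
G)(F(c_y)) dy` (`integral_payment_sub`). This is nonnegative because `G ≤ H`. It vanishes if `X` is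
constant wherever the ironed cost is: where `G < H` the hull is locally affine, the ironed cost is
locally constant, and no `c_y` can lie there. A BIC mechanism has antitone interim purchase
probabilities and pays at least the threshold payment (`le_interimPay`), so it pays at least its
expected ironed virtual cost. That cost is minimized profile by profile by buying from the `w`
lowest sellers, and for the ironed mechanism every inequality is an equality.

For (iii), the noise has mean zero and Mechanism 1 pays `n H(w/n)`. Relaxing "exactly `w` purchases"
to "`w` in expectation" bounds the optimum below by `n G(w/n)` (`mul_ironedCumulative_le`). Finally
`H ≤ r G` (`mul_quantile_le_ironedCumulative`): over an ironed interval with ends `l` and `u`, `G`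
is the chord of `H`, and `l ≥ u/r` keeps that chord above the line `q ↦ q u/r`. This already yields
the factor `r`; the remaining factor `2` is slack. -/

namespace Procurement

open ProbabilityTheory (cdf monotone_cdf cdf_nonneg cdf_le_one)

namespace HasPositiveDensity

variable {μ : Measure ℝ} [IsProbabilityMeasure μ] {f : ℝ → ℝ} {a b : ℝ}

/-! ### The density -/

theorem density_nonneg {μ : Measure ℝ} (hF : HasPositiveDensity μ f a b) (z : ℝ) : 0 ≤ f z := by
  by_cases hz : z ∈ Set.Icc a b
  · exact (hF.pos z hz).le
  · exact (hF.eq_zero z hz).ge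

/-- Off a finite set `f` is continuous on the interval and zero outside it, and changing a
measurable function at countably many points keeps it measurable. -/
theorem measurable_density {μ : Measure ℝ} (hF : HasPositiveDensity μ f a b) : Measurable f := by
  obtain ⟨D, hD, hc⟩ := hF.piecewise.continuousOn
  have hS : MeasurableSet (Set.Icc a b \ D) := measurableSet_Icc.diff hD.measurableSet
  classical
  have h1 : Measurable ((Set.Icc a b \ D).piecewise f (fun _ => 0)) :=
    ContinuousOn.measurable_piecewise hc continuousOn_const hS
  refine h1.measurable_of_countable_ne (hD.countable.mono fun z hz => ?_)
  by_contra hzD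
  apply hz
  by_cases hzI : z ∈ Set.Icc a b
  · exact Set.piecewise_eq_of_mem _ _ _ (Set.mem_sdiff_of_mem hzI hzD)
  · rw [Set.piecewise_eq_of_notMem _ _ _ (fun h => hzI h.1), hF.eq_zero z hzI]

theorem integral_eq {μ : Measure ℝ} (hF : HasPositiveDensity μ f a b) (g : ℝ → ℝ) :
    ∫ z, g z ∂μ = ∫ z in Set.Icc a b, f z * g z := by
  rw [hF.eq_withDensity, integral_withDensity_eq_integral_toReal_smul
    hF.measurable_density.ennreal_ofReal (by simp)]
  rw [← integral_indicator measurableSet_Icc]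
  congr 1 with z
  by_cases hz : z ∈ Set.Icc a b
  · simp [hz, ENNReal.toReal_ofReal (hF.density_nonneg z)]
  · simp [hz, hF.eq_zero z hz]

theorem integrable_iff {μ : Measure ℝ} (hF : HasPositiveDensity μ f a b) (g : ℝ → ℝ) :
    Integrable g μ ↔ IntegrableOn (fun z => f z * g z) (Set.Icc a b) := by
  rw [hF.eq_withDensity, integrable_withDensity_iff_integrable_smul'
    hF.measurable_density.ennreal_ofReal (by simp), ← integrable_indicator_iff measurableSet_Icc]
  apply integrable_congr (Eventually.of_forall fun z => ?_)
  by_cases hz : z ∈ Set.Icc a b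
  · simp [hz, ENNReal.toReal_ofReal (hF.density_nonneg z)]
  · simp [hz, hF.eq_zero z hz]

theorem absolutelyContinuous {μ : Measure ℝ} (hF : HasPositiveDensity μ f a b) : μ ≪ volume := by
  rw [hF.eq_withDensity]
  exact withDensity_absolutelyContinuous _ _

theorem noAtoms {μ : Measure ℝ} (hF : HasPositiveDensity μ f a b) (z : ℝ) : μ {z} = 0 :=
  hF.absolutelyContinuous (by simp)

/-- The right end point is removed because the ironed virtual cost is `⊤` from `b` on and real below
it. -/
theorem ae_mem {μ : Measure ℝ} (hF : HasPositiveDensity μ f a b) : ∀ᵐ z ∂μ, z ∈ Set.Ico a b := by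
  have h1 : ∀ᵐ z ∂μ, z ∈ Set.Icc a b := by
    rw [hF.eq_withDensity, ae_withDensity_iff hF.measurable_density.ennreal_ofReal]
    refine Eventually.of_forall fun z hz => ?_
    by_contra h
    exact hz (by simp [hF.eq_zero z h])
  have h2 : ∀ᵐ z ∂μ, z ≠ b := by
    rw [ae_iff]
    simpa using hF.noAtoms b
  filter_upwards [h1, h2] with z hz hzb
  exact ⟨hz.1, lt_of_le_of_ne hz.2 hzb⟩

theorem pos_right {μ : Measure ℝ} (hF : HasPositiveDensity μ f a b) : 0 < b :=
  hF.nonneg.trans_lt hF.lt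

/-! ### The distribution function and the quantile function -/

theorem cdf_of_le (hF : HasPositiveDensity μ f a b) {z : ℝ} (hz : z ≤ a) : cdf μ z = 0 := by
  rw [ProbabilityTheory.cdf_eq_real, measureReal_eq_zero_iff]
  have h : ∀ᵐ y ∂μ, y ∉ Set.Iic z := by
    have h2 : ∀ᵐ y ∂μ, y ≠ a := by
      rw [ae_iff]
      simpa using hF.noAtoms a
    filter_upwards [hF.ae_mem, h2] with y hy hya hyz
    exact hya (le_antisymm (le_trans hyz hz) hy.1)
  exact measure_eq_zero_iff_ae_notMem.2 h

theorem cdf_of_ge (hF : HasPositiveDensity μ f a b) {z : ℝ} (hz : b ≤ z) : cdf μ z = 1 := by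
  rw [ProbabilityTheory.cdf_eq_real, measureReal_def, ENNReal.toReal_eq_one_iff,
    ← prob_compl_eq_zero_iff measurableSet_Iic]
  have h : ∀ᵐ y ∂μ, y ∈ Set.Iic z := by
    filter_upwards [hF.ae_mem] with y hy
    exact hy.2.le.trans hz
  exact h

theorem strictMonoOn_cdf (hF : HasPositiveDensity μ f a b) :
    StrictMonoOn (cdf μ) (Set.Icc a b) := by
  intro x hx y hy hxy
  have h1 : cdf μ y - cdf μ x = μ.real (Set.Ioc x y) := by
    have := measureReal_sdiff (μ := μ) (Set.Iic_subset_Iic.2 hxy.le) measurableSet_Iic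
    rw [ProbabilityTheory.cdf_eq_real, ProbabilityTheory.cdf_eq_real, ← this]
    congr 1
    ext z; simp [and_comm]
  have h2 : 0 < μ.real (Set.Ioc x y) := by
    rw [measureReal_def, ENNReal.toReal_pos_iff]
    refine ⟨?_, measure_lt_top _ _⟩
    rw [hF.eq_withDensity, withDensity_apply _ measurableSet_Ioc,
      setLIntegral_pos_iff hF.measurable_density.ennreal_ofReal]
    have : Set.Ioc x y ⊆ Function.support (fun z => ENNReal.ofReal (f z)) ∩ Set.Ioc x y :=
      fun z hz => ⟨by
        simpa using hF.pos z ⟨hx.1.trans hz.1.le, hz.2.trans hy.2⟩, hz⟩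
    refine lt_of_lt_of_le ?_ (measure_mono this)
    simpa using hxy
  linarith

theorem cdf_lt_one (hF : HasPositiveDensity μ f a b) {z : ℝ} (hz : z < b) : cdf μ z < 1 := by
  have h := hF.strictMonoOn_cdf ⟨le_max_left a z, max_le hF.lt.le hz.le⟩
    ⟨hF.lt.le, le_rfl⟩ (max_lt hF.lt hz)
  rw [hF.cdf_of_ge le_rfl] at h
  exact (monotone_cdf μ (le_max_right a z)).trans_lt h

theorem continuous_cdf (hF : HasPositiveDensity μ f a b) : Continuous (cdf μ) := by
  rw [continuous_iff_continuousAt]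
  intro z
  have hz : (cdf μ).measure {z} = 0 := by
    rw [ProbabilityTheory.measure_cdf]; exact hF.noAtoms z
  rw [StieltjesFunction.measure_singleton, ENNReal.ofReal_eq_zero] at hz
  rw [continuousAt_iff_continuous_left'_right']
  constructor
  · rw [(monotone_cdf μ).continuousWithinAt_Iio_iff_leftLim_eq]
    exact le_antisymm ((monotone_cdf μ).leftLim_le le_rfl) (by linarith)
  · exact ((cdf μ).right_continuous z).mono Set.Ioi_subset_Ici_self

theorem surjOn_cdf (hF : HasPositiveDensity μ f a b) :
    Set.SurjOn (cdf μ) (Set.Icc a b) (Set.Icc 0 1) := by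
  have h := intermediate_value_Icc hF.lt.le (hF.continuous_cdf.continuousOn (s := Set.Icc a b))
  rwa [hF.cdf_of_le le_rfl, hF.cdf_of_ge le_rfl] at h

theorem quantile_mem (hF : HasPositiveDensity μ f a b) {q : ℝ} (hq : q ∈ Set.Icc (0 : ℝ) 1) :
    quantile μ a b q ∈ Set.Icc a b :=
  Function.invFunOn_mem (hF.surjOn_cdf hq)

theorem cdf_quantile (hF : HasPositiveDensity μ f a b) {q : ℝ} (hq : q ∈ Set.Icc (0 : ℝ) 1) :
    cdf μ (quantile μ a b q) = q :=
  Function.invFunOn_eq (f := fun z => cdf μ z) (hF.surjOn_cdf hq)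

theorem quantile_cdf (hF : HasPositiveDensity μ f a b) {z : ℝ} (hz : z ∈ Set.Icc a b) :
    quantile μ a b (cdf μ z) = z :=
  have h : cdf μ z ∈ Set.Icc (0 : ℝ) 1 := ⟨cdf_nonneg μ z, cdf_le_one μ z⟩
  hF.strictMonoOn_cdf.injOn (hF.quantile_mem h) hz (hF.cdf_quantile h)

theorem monotoneOn_quantile (hF : HasPositiveDensity μ f a b) :
    MonotoneOn (quantile μ a b) (Set.Icc 0 1) := by
  intro p hp q hq hpq
  rw [← hF.strictMonoOn_cdf.le_iff_le (hF.quantile_mem hp) (hF.quantile_mem hq),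
    hF.cdf_quantile hp, hF.cdf_quantile hq]
  exact hpq

/-- The bound `q < 1` is essential: at `q = 1` the left side holds for every `z`, also beyond `b`.
-/
theorem cdf_le_iff (hF : HasPositiveDensity μ f a b) {q z : ℝ} (hq : q ∈ Set.Ico (0 : ℝ) 1) :
    cdf μ z ≤ q ↔ z ≤ quantile μ a b q := by
  have hq' : q ∈ Set.Icc (0 : ℝ) 1 := ⟨hq.1, hq.2.le⟩
  constructor
  · intro h
    have hzb : z < b := by
      by_contra hzb
      rw [hF.cdf_of_ge (not_lt.1 hzb)] at h
      exact absurd hq.2 (not_lt.2 h)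
    -- Strict monotonicity is known only on `[a, b]`, so `z` is replaced by `max a z`.
    refine (le_max_right a z).trans ((hF.strictMonoOn_cdf.le_iff_le
      ⟨le_max_left a z, max_le hF.lt.le hzb.le⟩ (hF.quantile_mem hq')).1 ?_)
    rw [hF.cdf_quantile hq', (monotone_cdf μ).map_max, hF.cdf_of_le le_rfl]
    exact max_le hq.1 h
  · intro h
    exact (monotone_cdf μ h).trans_eq (hF.cdf_quantile hq')

/-- The probability integral transform: `F` of a random cost is uniform. It replaces the
substitution `t = F(z)`, which would need a derivative of `F`. -/
theorem map_cdf (hF : HasPositiveDensity μ f a b) :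
    μ.map (cdf μ) = volume.restrict (Set.Icc (0 : ℝ) 1) := by
  have hm : Measurable (cdf μ) := (monotone_cdf μ).measurable
  have : IsFiniteMeasure (μ.map (cdf μ)) := Measure.isFiniteMeasure_map μ _
  refine Measure.ext_of_Iic _ _ fun q => ?_
  rw [Measure.map_apply hm measurableSet_Iic, Measure.restrict_apply measurableSet_Iic]
  rcases lt_or_ge q 0 with hq0 | hq0
  · have h1 : cdf μ ⁻¹' Set.Iic q = ∅ := by
      ext z; simpa using hq0.trans_le (cdf_nonneg μ z)
    have h2 : Set.Iic q ∩ Set.Icc (0 : ℝ) 1 = ∅ := by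
      refine Set.eq_empty_of_forall_notMem fun z hz => ?_
      exact absurd (hz.2.1.trans hz.1) (not_le.2 hq0)
    simp [h1, h2]
  rcases lt_or_ge q 1 with hq1 | hq1
  · have h1 : cdf μ ⁻¹' Set.Iic q = Set.Iic (quantile μ a b q) := by
      ext z; exact hF.cdf_le_iff ⟨hq0, hq1⟩
    have h2 : Set.Iic q ∩ Set.Icc (0 : ℝ) 1 = Set.Icc 0 q := by
      ext z; simp only [Set.mem_inter_iff, Set.mem_Iic, Set.mem_Icc]
      constructor
      · rintro ⟨h, h', -⟩; exact ⟨h', h⟩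
      · rintro ⟨h, h'⟩; exact ⟨h', h, h'.trans hq1.le⟩
    rw [h1, h2, Real.volume_Icc, ← ProbabilityTheory.ofReal_cdf, hF.cdf_quantile ⟨hq0, hq1.le⟩,
      sub_zero]
  · have h1 : cdf μ ⁻¹' Set.Iic q = Set.univ := by
      ext z; simpa using (cdf_le_one μ z).trans hq1
    have h2 : Set.Iic q ∩ Set.Icc (0 : ℝ) 1 = Set.Icc 0 1 := by
      ext z; simp only [Set.mem_inter_iff, Set.mem_Iic, Set.mem_Icc]
      exact ⟨fun h => h.2, fun h => ⟨h.2.trans hq1, h⟩⟩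
    simp [h1, h2]

/-! ### Payments of threshold form and the cumulative virtual cost -/

theorem integrable_of_bounded (hF : HasPositiveDensity μ f a b) {g : ℝ → ℝ}
    (hg : Measurable g) {C : ℝ} (hC : ∀ z ∈ Set.Icc a b, |g z| ≤ C) : Integrable g μ := by
  refine Integrable.of_bound hg.aestronglyMeasurable C ?_
  filter_upwards [hF.ae_mem] with z hz
  exact hC z ⟨hz.1, hz.2.le⟩

theorem integrableOn_density_mul (hF : HasPositiveDensity μ f a b) {g : ℝ → ℝ}
    (hg : Measurable g) {C : ℝ} (hC : ∀ z ∈ Set.Icc a b, |g z| ≤ C) :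
    IntegrableOn (fun z => f z * g z) (Set.Icc a b) :=
  (hF.integrable_iff g).1 (hF.integrable_of_bounded hg hC)

theorem integrableOn_mul_cdf {μ : Measure ℝ} {X : ℝ → ℝ} (hX : Measurable X) {C : ℝ}
    (hC : ∀ z ∈ Set.Icc a b, |X z| ≤ C) :
    IntegrableOn (fun z => X z * cdf μ z) (Set.Icc a b) := by
  refine Measure.integrableOn_of_bounded (M := C) (by simp)
    (hX.mul (monotone_cdf μ).measurable).aestronglyMeasurable ?_
  filter_upwards [ae_restrict_mem measurableSet_Icc] with z hz
  rw [norm_mul, Real.norm_eq_abs, Real.norm_eq_abs, abs_of_nonneg (cdf_nonneg μ z)]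
  exact (mul_le_of_le_one_right (abs_nonneg _) (cdf_le_one μ z)).trans (hC z hz)

theorem abs_mul_le {μ : Measure ℝ} (hF : HasPositiveDensity μ f a b) {X : ℝ → ℝ} {C : ℝ}
    (hC : ∀ z ∈ Set.Icc a b, |X z| ≤ C) : ∀ z ∈ Set.Icc a b, |z * X z| ≤ b * C := by
  intro z hz
  rw [abs_mul, abs_of_nonneg (hF.nonneg.trans hz.1)]
  exact mul_le_mul hz.2 (hC z hz) (abs_nonneg _) hF.pos_right.le

theorem integrableOn_mul_density_add_cdf (hF : HasPositiveDensity μ f a b) {X : ℝ → ℝ}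
    (hX : Measurable X) {C : ℝ} (hC : ∀ z ∈ Set.Icc a b, |X z| ≤ C) :
    IntegrableOn (fun z => X z * (z * f z + cdf μ z)) (Set.Icc a b) := by
  have h := (hF.integrableOn_density_mul (measurable_id.mul hX) (hF.abs_mul_le hC)).add
    (integrableOn_mul_cdf (μ := μ) hX hC)
  refine h.congr (Eventually.of_forall fun z => ?_)
  simp; ring

/-- For the kernel `X(s) 1_{z < s}`, integrating in `s` first gives the threshold term `∫_z^b X`,
and integrating in `z` first gives `X(s) F(s)`. Its integrability licenses the swap. -/
theorem integrableOn_tail_kernel {X : ℝ → ℝ} (hX : Measurable X) {C : ℝ}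
    (hC : ∀ z ∈ Set.Icc a b, |X z| ≤ C) :
    Integrable (fun p : ℝ × ℝ => (Set.Ioi p.1).indicator X p.2)
      (μ.prod (volume.restrict (Set.Icc a b))) := by
  have hm : Measurable (fun p : ℝ × ℝ => (Set.Ioi p.1).indicator X p.2) := by
    have : (fun p : ℝ × ℝ => (Set.Ioi p.1).indicator X p.2) =
        {p : ℝ × ℝ | p.1 < p.2}.indicator (fun p => X p.2) := by
      ext p; simp [Set.indicator]
    rw [this]
    exact (hX.comp measurable_snd).indicator (measurableSet_lt measurable_fst measurable_snd)
  refine Integrable.of_bound hm.aestronglyMeasurable C ?_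
  have : ∀ᵐ p ∂(μ.prod (volume.restrict (Set.Icc a b))), p.2 ∈ Set.Icc a b :=
    Measure.quasiMeasurePreserving_snd.ae (ae_restrict_mem measurableSet_Icc)
  filter_upwards [this] with p hp
  by_cases h : p.2 ∈ Set.Ioi p.1
  · rw [Set.indicator_of_mem h]; exact hC _ hp
  · rw [Set.indicator_of_notMem h, norm_zero]; exact (abs_nonneg _).trans (hC _ hp)

theorem setIntegral_indicator_Ioi {X : ℝ → ℝ} {z : ℝ} (hz : a ≤ z) :
    ∫ s in Set.Icc a b, (Set.Ioi z).indicator X s = ∫ s in Set.Ioc z b, X s := by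
  rw [setIntegral_indicator measurableSet_Ioi]
  congr 2
  ext s; simp only [Set.mem_inter_iff, Set.mem_Icc, Set.mem_Ioi, Set.mem_Ioc]
  exact ⟨fun h => ⟨h.2, h.1.2⟩, fun h => ⟨⟨hz.trans h.1.le, h.2⟩, h.1⟩⟩

/-- The expected payment of a threshold rule is the integral of its virtual cost. -/
theorem integral_payment (hF : HasPositiveDensity μ f a b) {X : ℝ → ℝ}
    (hX : Measurable X) {C : ℝ} (hC : ∀ z ∈ Set.Icc a b, |X z| ≤ C) :
    Integrable (fun z => z * X z + ∫ s in Set.Ioc z b, X s) μ ∧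
    ∫ z, (z * X z + ∫ s in Set.Ioc z b, X s) ∂μ =
      ∫ z in Set.Icc a b, X z * (z * f z + cdf μ z) := by
  have hk := integrableOn_tail_kernel (μ := μ) hX hC
  have h1 : Integrable (fun z => z * X z) μ :=
    hF.integrable_of_bounded (measurable_id.mul hX) (hF.abs_mul_le hC)
  have hae : (fun z => ∫ s in Set.Icc a b, (Set.Ioi z).indicator X s) =ᵐ[μ]
      fun z => ∫ s in Set.Ioc z b, X s := by
    filter_upwards [hF.ae_mem] with z hz
    exact setIntegral_indicator_Ioi hz.1
  have h2 : Integrable (fun z => ∫ s in Set.Ioc z b, X s) μ := hk.integral_prod_left.congr hae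
  refine ⟨h1.add h2, ?_⟩
  rw [integral_add h1 h2, ← integral_congr_ae hae, integral_integral_swap hk, hF.integral_eq]
  -- The costs strictly below `s` have mass `F(s)`, as there are no atoms.
  have h3 : ∀ s, ∫ z, (Set.Ioi z).indicator X s ∂μ = X s * cdf μ s := by
    intro s
    have h4 : (fun z => (Set.Ioi z).indicator X s) = (Set.Iio s).indicator (fun _ => X s) := by
      ext z; simp [Set.indicator]
    rw [h4, integral_indicator_const _ measurableSet_Iio, smul_eq_mul, mul_comm,
      ProbabilityTheory.cdf_eq_real]
    congr 1
    rw [measureReal_def, measureReal_def, ← Set.Iio_union_right]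
    congr 1
    refine le_antisymm (measure_mono Set.subset_union_left) ((measure_union_le _ _).trans ?_)
    rw [hF.noAtoms s, add_zero]
  simp_rw [h3]
  have h5 := integral_add (hF.integrableOn_density_mul (measurable_id.mul hX) (hF.abs_mul_le hC))
    (integrableOn_mul_cdf (μ := μ) hX hC)
  simp only [Pi.mul_apply, id] at h5
  rw [← h5]
  congr 1 with z
  ring

/-- Apply `integral_payment` to the rule `1_{z ≤ c}`: exactly the sellers with cost at most `c` are
paid, each the amount `c`. -/
theorem setIntegral_mul_density_add_cdf (hF : HasPositiveDensity μ f a b) {c : ℝ}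
    (hc : c ∈ Set.Icc a b) :
    ∫ z in Set.Icc a c, (z * f z + cdf μ z) = c * cdf μ c := by
  have hX : Measurable ((Set.Iic c).indicator (fun _ : ℝ => (1 : ℝ))) :=
    measurable_const.indicator measurableSet_Iic
  have hC : ∀ z ∈ Set.Icc a b, |(Set.Iic c).indicator (fun _ : ℝ => (1 : ℝ)) z| ≤ 1 := by
    intro z _
    by_cases h : z ∈ Set.Iic c <;> simp [h]
  have h := (hF.integral_payment hX hC).2
  have h1 : (fun z => z * (Set.Iic c).indicator (fun _ : ℝ => (1 : ℝ)) z +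
      ∫ s in Set.Ioc z b, (Set.Iic c).indicator (fun _ : ℝ => (1 : ℝ)) s) =
      (Set.Iic c).indicator (fun _ => c) := by
    ext z
    rw [setIntegral_indicator measurableSet_Iic]
    have : Set.Ioc z b ∩ Set.Iic c = Set.Ioc z c := by
      ext s; simp only [Set.mem_inter_iff, Set.mem_Ioc, Set.mem_Iic]
      exact ⟨fun h => ⟨h.1.1, h.2⟩, fun h => ⟨⟨h.1, h.2.trans hc.2⟩, h.2⟩⟩
    rw [this]
    by_cases hz : z ≤ c
    · simp [hz]
    · simp [hz, le_of_not_ge hz]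
  rw [h1, integral_indicator_const _ measurableSet_Iic, ← ProbabilityTheory.cdf_eq_real,
    smul_eq_mul] at h
  rw [mul_comm, h]
  have h2 : (fun z => (Set.Iic c).indicator (fun _ : ℝ => (1 : ℝ)) z * (z * f z + cdf μ z)) =
      (Set.Iic c).indicator (fun z => z * f z + cdf μ z) := by
    ext z
    by_cases h : z ∈ Set.Iic c <;> simp [h]
  rw [h2, setIntegral_indicator measurableSet_Iic]
  congr 2
  ext s; simp only [Set.mem_inter_iff, Set.mem_Icc, Set.mem_Iic]
  exact ⟨fun h => ⟨⟨h.1, h.2.trans hc.2⟩, h.2⟩, fun h => ⟨h.1.1, h.2⟩⟩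

/-! ### The virtual cost in quantile space -/

theorem measurable_virtualCost {μ : Measure ℝ} (hF : HasPositiveDensity μ f a b) :
    Measurable (virtualCost μ f) :=
  measurable_id.add ((monotone_cdf μ).measurable.div hF.measurable_density)

theorem aestronglyMeasurable_virtualCost_quantile (hF : HasPositiveDensity μ f a b) :
    AEStronglyMeasurable (fun t => virtualCost μ f (quantile μ a b t))
      (volume.restrict (Set.Icc 0 1)) :=
  (hF.measurable_virtualCost.comp_aemeasurable
    (aemeasurable_restrict_of_monotoneOn measurableSet_Icc hF.monotoneOn_quantile)).aestronglyMeasurable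

theorem density_mul_virtualCost {μ : Measure ℝ} (hF : HasPositiveDensity μ f a b) {z : ℝ}
    (hz : z ∈ Set.Icc a b) : f z * virtualCost μ f z = z * f z + cdf μ z := by
  have := (hF.pos z hz).ne'
  rw [virtualCost]; field_simp

/-- The virtual cost itself may be unbounded, since `f` may have a one-sided limit zero. Its product
with the density is `z f(z) + F(z)`, which is integrable, and `map_cdf` brings that product in. -/
theorem integrableOn_virtualCost_quantile (hF : HasPositiveDensity μ f a b) :
    IntegrableOn (fun t => virtualCost μ f (quantile μ a b t)) (Set.Icc 0 1) := by
  have hm : AEMeasurable (cdf μ) μ := (monotone_cdf μ).measurable.aemeasurable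
  have h0 := hF.aestronglyMeasurable_virtualCost_quantile
  rw [IntegrableOn, ← hF.map_cdf]
  rw [← hF.map_cdf] at h0
  rw [integrable_map_measure h0 hm, hF.integrable_iff]
  have h1 := hF.integrableOn_mul_density_add_cdf (X := fun _ => 1) (C := 1) measurable_const
    (by simp)
  refine h1.congr_fun (fun z hz => ?_) measurableSet_Icc
  simp only [Function.comp, one_mul, hF.quantile_cdf hz, hF.density_mul_virtualCost hz]

theorem continuousOn_cumulativeVirtualCost (hF : HasPositiveDensity μ f a b) :
    ContinuousOn (cumulativeVirtualCost μ f a b) (Set.Icc 0 1) :=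
  have h : Set.uIcc (0 : ℝ) 1 = Set.Icc 0 1 := Set.uIcc_of_le zero_le_one
  h ▸ intervalIntegral.continuousOn_primitive_interval
    (f := fun t => virtualCost μ f (quantile μ a b t)) (μ := volume) (a := (0 : ℝ)) (b := 1)
    (h ▸ hF.integrableOn_virtualCost_quantile)

/-- The substitution `t = F(z)`, obtained by applying `map_cdf` to `g` truncated at `F(c)`. It
serves both the virtual cost and the slope of the hull. -/
theorem setIntegral_density_mul_comp_cdf (hF : HasPositiveDensity μ f a b) {g : ℝ → ℝ}
    (hg : AEStronglyMeasurable g (volume.restrict (Set.Icc 0 1))) {c : ℝ} (hc : c ∈ Set.Icc a b) :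
    ∫ z in Set.Icc a c, f z * g (cdf μ z) = ∫ t in (0 : ℝ)..cdf μ c, g t := by
  have hm : AEMeasurable (cdf μ) μ := (monotone_cdf μ).measurable.aemeasurable
  have h1 : Set.Iic (cdf μ c) ∩ Set.Icc (0 : ℝ) 1 = Set.Icc 0 (cdf μ c) := by
    ext z; simp only [Set.mem_inter_iff, Set.mem_Iic, Set.mem_Icc]
    exact ⟨fun h => ⟨h.2.1, h.1⟩, fun h => ⟨h.2, h.1, h.2.trans (cdf_le_one μ c)⟩⟩
  have h2 : ∫ t in Set.Icc 0 (cdf μ c), g t =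
      ∫ t, (Set.Iic (cdf μ c)).indicator g t ∂(volume.restrict (Set.Icc (0 : ℝ) 1)) := by
    rw [integral_indicator measurableSet_Iic, Measure.restrict_restrict measurableSet_Iic, h1]
  have hg' := hg.indicator (measurableSet_Iic (a := cdf μ c))
  rw [intervalIntegral.integral_of_le (cdf_nonneg μ c), ← integral_Icc_eq_integral_Ioc, h2]
  rw [← hF.map_cdf] at hg' ⊢
  rw [integral_map hm hg', hF.integral_eq]
  have h3 : ∀ z ∈ Set.Icc a b, f z * (Set.Iic (cdf μ c)).indicator g (cdf μ z) =
      (Set.Iic c).indicator (fun z => f z * g (cdf μ z)) z := by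
    intro z hz
    have h4 : cdf μ z ≤ cdf μ c ↔ z ≤ c := hF.strictMonoOn_cdf.le_iff_le hz hc
    by_cases h : z ≤ c
    · rw [Set.indicator_of_mem (Set.mem_Iic.2 (h4.2 h)), Set.indicator_of_mem (Set.mem_Iic.2 h)]
    · rw [Set.indicator_of_notMem (s := Set.Iic (cdf μ c)) (fun h' => h (h4.1 h')),
        Set.indicator_of_notMem (s := Set.Iic c) h, mul_zero]
  rw [setIntegral_congr_fun measurableSet_Icc h3, setIntegral_indicator measurableSet_Iic]
  have h5 : Set.Icc a b ∩ Set.Iic c = Set.Icc a c := by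
    ext s; simp only [Set.mem_inter_iff, Set.mem_Icc, Set.mem_Iic]
    exact ⟨fun h => ⟨h.1.1, h.2⟩, fun h => ⟨⟨h.1, h.2.trans hc.2⟩, h.2⟩⟩
  rw [h5]

theorem cumulativeVirtualCost_cdf (hF : HasPositiveDensity μ f a b) {z : ℝ}
    (hz : z ∈ Set.Icc a b) :
    cumulativeVirtualCost μ f a b (cdf μ z) = z * cdf μ z := by
  rw [cumulativeVirtualCost, ← hF.setIntegral_density_mul_comp_cdf
    hF.aestronglyMeasurable_virtualCost_quantile hz, ← hF.setIntegral_mul_density_add_cdf hz]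
  refine setIntegral_congr_fun measurableSet_Icc fun y hy => ?_
  have hy' : y ∈ Set.Icc a b := ⟨hy.1, hy.2.trans hz.2⟩
  simp only [hF.quantile_cdf hy', hF.density_mul_virtualCost hy']

/-- `H(q)` is the expected payment to one seller under the posted price `F⁻¹(q)`. This links `H` to
Mechanism 1 and makes its sign evident. -/
theorem cumulativeVirtualCost_eq (hF : HasPositiveDensity μ f a b) {q : ℝ}
    (hq : q ∈ Set.Icc (0 : ℝ) 1) :
    cumulativeVirtualCost μ f a b q = q * quantile μ a b q := by
  have h := hF.cumulativeVirtualCost_cdf (hF.quantile_mem hq)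
  rw [hF.cdf_quantile hq] at h
  rw [h, mul_comm]

theorem cumulativeVirtualCost_nonneg (hF : HasPositiveDensity μ f a b) :
    ∀ q ∈ Set.Icc (0 : ℝ) 1, 0 ≤ cumulativeVirtualCost μ f a b q := by
  intro q hq
  rw [hF.cumulativeVirtualCost_eq hq]
  exact mul_nonneg hq.1 (hF.nonneg.trans (hF.quantile_mem hq).1)

theorem cumulativeVirtualCost_zero {μ : Measure ℝ} :
    cumulativeVirtualCost μ f a b 0 = 0 :=
  intervalIntegral.integral_same

end HasPositiveDensity

/-! ### The lower convex hull of a function on the unit interval -/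

section LowerConvexHull

variable {H : ℝ → ℝ}

/-- The epigraph of a convex minorant is a convex set containing the epigraph of `H`, hence also the
hull of the latter. Lower bounds on the hull come from a suitable choice of `m`. -/
theorem le_of_mem_convexHull_epigraph {m : ℝ → ℝ} (hm : ConvexOn ℝ (Set.Icc 0 1) m)
    (hmH : ∀ q ∈ Set.Icc (0 : ℝ) 1, m q ≤ H q) {q y : ℝ}
    (h : (q, y) ∈ convexHull ℝ {p : ℝ × ℝ | p.1 ∈ Set.Icc (0 : ℝ) 1 ∧ H p.1 ≤ p.2}) :
    q ∈ Set.Icc (0 : ℝ) 1 ∧ m q ≤ y := by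
  have hsub : {p : ℝ × ℝ | p.1 ∈ Set.Icc (0 : ℝ) 1 ∧ H p.1 ≤ p.2} ⊆
      {p : ℝ × ℝ | p.1 ∈ Set.Icc (0 : ℝ) 1 ∧ m p.1 ≤ p.2} :=
    fun p hp => ⟨hp.1, (hmH _ hp.1).trans hp.2⟩
  exact convexHull_min hsub hm.convex_epigraph h

theorem mem_convexHull_epigraph {q y : ℝ} (hq : q ∈ Set.Icc (0 : ℝ) 1) (hy : H q ≤ y) :
    (q, y) ∈ convexHull ℝ {p : ℝ × ℝ | p.1 ∈ Set.Icc (0 : ℝ) 1 ∧ H p.1 ≤ p.2} :=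
  subset_convexHull ℝ _ ⟨hq, hy⟩

theorem le_lowerConvexHull {m : ℝ → ℝ} (hm : ConvexOn ℝ (Set.Icc 0 1) m)
    (hmH : ∀ q ∈ Set.Icc (0 : ℝ) 1, m q ≤ H q) {q : ℝ} (hq : q ∈ Set.Icc (0 : ℝ) 1) :
    m q ≤ lowerConvexHull H q :=
  le_csInf ⟨H q, mem_convexHull_epigraph hq le_rfl⟩
    fun _ hy => (le_of_mem_convexHull_epigraph hm hmH hy).2

/-- Needed because `sInf` of a set unbounded below takes the default value `0`. -/
theorem bddBelow_slice (hH : ∀ q ∈ Set.Icc (0 : ℝ) 1, 0 ≤ H q) (q : ℝ) :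
    BddBelow {y : ℝ | (q, y) ∈ convexHull ℝ {p : ℝ × ℝ | p.1 ∈ Set.Icc (0 : ℝ) 1 ∧ H p.1 ≤ p.2}} :=
  ⟨0, fun _ hy => (le_of_mem_convexHull_epigraph (convexOn_const 0 (convex_Icc 0 1)) hH hy).2⟩

theorem lowerConvexHull_le (hH : ∀ q ∈ Set.Icc (0 : ℝ) 1, 0 ≤ H q) {q : ℝ}
    (hq : q ∈ Set.Icc (0 : ℝ) 1) : lowerConvexHull H q ≤ H q :=
  csInf_le (bddBelow_slice hH q) (mem_convexHull_epigraph hq le_rfl)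

theorem lowerConvexHull_nonneg (hH : ∀ q ∈ Set.Icc (0 : ℝ) 1, 0 ≤ H q) {q : ℝ}
    (hq : q ∈ Set.Icc (0 : ℝ) 1) : 0 ≤ lowerConvexHull H q :=
  le_lowerConvexHull (convexOn_const 0 (convex_Icc 0 1)) hH hq

theorem convexOn_lowerConvexHull (hH : ∀ q ∈ Set.Icc (0 : ℝ) 1, 0 ≤ H q) :
    ConvexOn ℝ (Set.Icc 0 1) (lowerConvexHull H) := by
  refine ⟨convex_Icc 0 1, fun x hx y hy s t hs ht hst => ?_⟩
  -- The infimum is not known to be attained, so points of the hull within `ε` of it are combined.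
  refine le_of_forall_pos_le_add fun ε hε => ?_
  obtain ⟨u, hu, hu'⟩ := exists_lt_of_csInf_lt ⟨H x, mem_convexHull_epigraph hx le_rfl⟩
    (lt_add_of_pos_right (lowerConvexHull H x) hε)
  obtain ⟨v, hv, hv'⟩ := exists_lt_of_csInf_lt ⟨H y, mem_convexHull_epigraph hy le_rfl⟩
    (lt_add_of_pos_right (lowerConvexHull H y) hε)
  have h := convex_convexHull ℝ _ hu hv hs ht hst
  have h1 : lowerConvexHull H (s • x + t • y) ≤ s • u + t • v := csInf_le (bddBelow_slice hH _) h
  simp only [smul_eq_mul] at h1 ⊢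
  nlinarith [mul_le_mul_of_nonneg_left hu'.le hs, mul_le_mul_of_nonneg_left hv'.le ht]

theorem lowerConvexHull_zero (hH : ∀ q ∈ Set.Icc (0 : ℝ) 1, 0 ≤ H q) (h0 : H 0 = 0) :
    lowerConvexHull H 0 = 0 :=
  le_antisymm ((lowerConvexHull_le hH (by simp)).trans_eq h0) (lowerConvexHull_nonneg hH (by simp))

/-- Steep affine minorants reach up to the value at the right end point. -/
theorem exists_affine_le_lowerConvexHull (hH : ∀ q ∈ Set.Icc (0 : ℝ) 1, 0 ≤ H q)
    (hc : ContinuousOn H (Set.Icc 0 1)) {ε : ℝ} (hε : 0 < ε) :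
    ∃ N : ℝ, ∀ q ∈ Set.Icc (0 : ℝ) 1, H 1 - ε - N * (1 - q) ≤ lowerConvexHull H q := by
  obtain ⟨δ, hδ, h⟩ := Metric.continuousOn_iff.1 hc 1 (by simp) ε hε
  have h1 : 0 ≤ H 1 := hH 1 (by simp)
  -- Within `δ` of `1` continuity gives `H ≥ H 1 - ε`; farther away the slope `H 1 / δ` has pushed
  -- the affine function below `-ε`, hence below `H`.
  refine ⟨H 1 / δ, fun q hq => le_lowerConvexHull (m := fun q => H 1 - ε - H 1 / δ * (1 - q))
    ?_ (fun p hp => ?_) hq⟩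
  · refine ⟨convex_Icc 0 1, fun x _ y _ s t _ _ hst => le_of_eq ?_⟩
    simp only [smul_eq_mul]
    linear_combination (-(H 1 - ε - H 1 / δ)) * hst
  · have hN : 0 ≤ H 1 / δ := div_nonneg h1 hδ.le
    rcases lt_or_ge (1 - p) δ with hp1 | hp1
    · have h2 := h p hp (by rw [Real.dist_eq, abs_sub_comm, abs_of_nonneg (by linarith [hp.2])]; exact hp1)
      rw [Real.dist_eq] at h2
      have := (abs_lt.1 h2).1
      have := mul_nonneg hN (sub_nonneg.2 hp.2)
      linarith
    · have h2 := mul_le_mul_of_nonneg_left hp1 hN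
      rw [div_mul_cancel₀ _ hδ.ne'] at h2
      linarith [hH p hp]

theorem lowerConvexHull_one (hH : ∀ q ∈ Set.Icc (0 : ℝ) 1, 0 ≤ H q)
    (hc : ContinuousOn H (Set.Icc 0 1)) : lowerConvexHull H 1 = H 1 := by
  refine le_antisymm (lowerConvexHull_le hH (by simp)) (le_of_forall_pos_le_add fun ε hε => ?_)
  obtain ⟨N, hN⟩ := exists_affine_le_lowerConvexHull hH hc hε
  have := hN 1 (by simp)
  linarith

/-- Convexity settles the interior. At `0` the hull is squeezed between `0` and `H`; at `1` it is
squeezed between steep affine minorants and `H`. -/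
theorem continuousOn_lowerConvexHull (hH : ∀ q ∈ Set.Icc (0 : ℝ) 1, 0 ≤ H q) (h0 : H 0 = 0)
    (hc : ContinuousOn H (Set.Icc 0 1)) : ContinuousOn (lowerConvexHull H) (Set.Icc 0 1) := by
  intro q hq
  rcases eq_or_lt_of_le hq.1 with rfl | hq0
  · have h := hc 0 hq
    rw [ContinuousWithinAt, h0] at h
    rw [ContinuousWithinAt, lowerConvexHull_zero hH h0]
    refine tendsto_of_tendsto_of_tendsto_of_le_of_le' tendsto_const_nhds h ?_ ?_
    · filter_upwards [self_mem_nhdsWithin] with p hp using lowerConvexHull_nonneg hH hp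
    · filter_upwards [self_mem_nhdsWithin] with p hp using lowerConvexHull_le hH hp
  rcases eq_or_lt_of_le hq.2 with rfl | hq1
  · rw [ContinuousWithinAt, lowerConvexHull_one hH hc, tendsto_order]
    constructor
    · intro y hy
      obtain ⟨N, hN⟩ := exists_affine_le_lowerConvexHull hH hc (half_pos (sub_pos.2 hy))
      have hlim : Tendsto (fun p : ℝ => H 1 - (H 1 - y) / 2 - N * (1 - p)) (𝓝[Set.Icc 0 1] 1)
          (𝓝 (H 1 - (H 1 - y) / 2 - N * (1 - 1))) :=
        (Continuous.tendsto (by fun_prop) 1).mono_left nhdsWithin_le_nhds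
      have h1 := hlim.eventually (lt_mem_nhds (a := y) (by linarith))
      filter_upwards [h1, self_mem_nhdsWithin] with p hp hpI using hp.trans_le (hN p hpI)
    · intro y hy
      filter_upwards [(hc 1 hq).eventually (gt_mem_nhds hy), self_mem_nhdsWithin] with p hp hpI
        using (lowerConvexHull_le hH hpI).trans_lt hp
  · have h1 := (convexOn_lowerConvexHull hH).continuousOn_interior
    rw [interior_Icc] at h1
    exact (h1.continuousAt (Ioo_mem_nhds hq0 hq1)).continuousWithinAt

/-- A convex function lies above its chords outside of their base. -/
theorem _root_.ConvexOn.chord_le {S : Set ℝ} {G : ℝ → ℝ} (hG : ConvexOn ℝ S G) {u v x : ℝ} (hu : u ∈ S)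
    (hv : v ∈ S) (hx : x ∈ S) (huv : u < v) (h : x ≤ u ∨ v ≤ x) :
    G u + (G v - G u) / (v - u) * (x - u) ≤ G x := by
  have huv' : 0 < v - u := sub_pos.2 huv
  rcases h with h | h
  · rcases eq_or_lt_of_le h with rfl | h
    · simp
    have h1 := hG.slope_mono_adjacent hx hv h huv
    rw [div_le_iff₀ (sub_pos.2 h)] at h1
    linarith
  · rcases eq_or_lt_of_le h with rfl | h
    · rw [div_mul_cancel₀ _ huv'.ne']; linarith
    have h1 := hG.slope_mono_adjacent hu hx huv h
    rw [le_div_iff₀ (sub_pos.2 h)] at h1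
    have h2 : (G v - G u) / (v - u) * (v - u) = G v - G u := div_mul_cancel₀ _ huv'.ne'
    nlinarith

theorem _root_.ConvexOn.le_chord {S : Set ℝ} {G : ℝ → ℝ} (hG : ConvexOn ℝ S G) {u v x : ℝ} (hu : u ∈ S)
    (hv : v ∈ S) (huv : u < v) (hux : u ≤ x) (hxv : x ≤ v) :
    G x ≤ G u + (G v - G u) / (v - u) * (x - u) := by
  have huv' : 0 < v - u := sub_pos.2 huv
  have h := hG.2 hu hv (div_nonneg (sub_nonneg.2 hxv) huv'.le)
    (div_nonneg (sub_nonneg.2 hux) huv'.le) (by field_simp; ring)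
  simp only [smul_eq_mul] at h
  have h1 : (v - x) / (v - u) * u + (x - u) / (v - u) * v = x := by field_simp; ring
  rw [h1] at h
  refine h.trans_eq ?_
  field_simp; ring

/-- Where the hull is strictly below the function it is locally affine. -/
theorem lowerConvexHull_eventuallyEq_affine (hH : ∀ q ∈ Set.Icc (0 : ℝ) 1, 0 ≤ H q)
    (h0 : H 0 = 0) (hc : ContinuousOn H (Set.Icc 0 1)) {q : ℝ} (hq : q ∈ Set.Icc (0 : ℝ) 1)
    (hne : H q ≠ lowerConvexHull H q) :
    q ∈ Set.Ioo (0 : ℝ) 1 ∧ ∃ α β : ℝ, lowerConvexHull H =ᶠ[𝓝 q] fun p => α + β * p := by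
  have hq0 : 0 < q := by
    refine lt_of_le_of_ne hq.1 ?_
    rintro rfl
    exact hne (h0.trans (lowerConvexHull_zero hH h0).symm)
  have hq1 : q < 1 := by
    refine lt_of_le_of_ne hq.2 ?_
    rintro rfl
    exact hne (lowerConvexHull_one hH hc).symm
  refine ⟨⟨hq0, hq1⟩, ?_⟩
  have hlt : lowerConvexHull H q < H q := lt_of_le_of_ne (lowerConvexHull_le hH hq) hne.symm
  -- A level `d` strictly between hull and function separates the two on a whole neighbourhood of
  -- `q`.
  obtain ⟨d, hd1, hd2⟩ := exists_between hlt
  have hI : Set.Icc (0 : ℝ) 1 ∈ 𝓝 q := Icc_mem_nhds hq0 hq1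
  have hG := convexOn_lowerConvexHull hH
  have hev : ∀ᶠ p in 𝓝 q, lowerConvexHull H p < d ∧ d < H p ∧ p ∈ Set.Icc (0 : ℝ) 1 :=
    ((((continuousOn_lowerConvexHull hH h0 hc).continuousAt hI).eventually (gt_mem_nhds hd1))).and
      (((hc.continuousAt hI).eventually (lt_mem_nhds hd2)).and hI)
  obtain ⟨ε, hε, hball⟩ := Metric.eventually_nhds_iff.1 hev
  set u := q - ε / 2 with hu
  set v := q + ε / 2 with hv
  have hin : ∀ p ∈ Set.Icc u v, lowerConvexHull H p < d ∧ d < H p ∧ p ∈ Set.Icc (0 : ℝ) 1 := by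
    intro p hp
    apply hball
    rw [Real.dist_eq, abs_lt]
    constructor <;> linarith [hp.1, hp.2]
  have huv : u < v := by linarith
  have hum := hin u ⟨le_rfl, huv.le⟩
  have hvm := hin v ⟨huv.le, le_rfl⟩
  set β := (lowerConvexHull H v - lowerConvexHull H u) / (v - u) with hβ
  set L : ℝ → ℝ := fun p => lowerConvexHull H u + β * (p - u) with hL
  have hLv : L v = lowerConvexHull H v := by
    simp only [hL, hβ]; rw [div_mul_cancel₀ _ (sub_pos.2 huv).ne']; ring
  have hLconv : ConvexOn ℝ (Set.Icc 0 1) L := by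
    refine ⟨convex_Icc 0 1, fun x _ y _ s t _ _ hst => le_of_eq ?_⟩
    simp only [hL, smul_eq_mul]
    linear_combination (-(lowerConvexHull H u - β * u)) * hst
  -- Key point: raising the hull to its chord `L` still gives a convex minorant of `H`, because
  -- outside `[u, v]` the chord lies below the hull and inside it lies below `d`. Maximality then
  -- forces the hull up to `L`.
  have hmax : ∀ p ∈ Set.Icc (0 : ℝ) 1, (lowerConvexHull H ⊔ L) p ≤ H p := by
    intro p hp
    refine max_le (lowerConvexHull_le hH hp) ?_
    by_cases hpu : p ≤ u
    · exact (hG.chord_le hum.2.2 hvm.2.2 hp huv (Or.inl hpu)).trans (lowerConvexHull_le hH hp)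
    by_cases hpv : v ≤ p
    · exact (hG.chord_le hum.2.2 hvm.2.2 hp huv (Or.inr hpv)).trans (lowerConvexHull_le hH hp)
    have hp' : p ∈ Set.Icc u v := ⟨(not_le.1 hpu).le, (not_le.1 hpv).le⟩
    refine le_trans ?_ (hin p hp').2.1.le
    rcases le_or_gt 0 β with hβ0 | hβ0
    · have : L p ≤ L v := by
        simp only [hL]; gcongr; exact hp'.2
      exact this.trans (hLv.le.trans hvm.1.le)
    · have : β * (p - u) ≤ 0 := mul_nonpos_of_nonpos_of_nonneg hβ0.le (sub_nonneg.2 hp'.1)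
      simp only [hL]; linarith [hum.1]
  refine ⟨lowerConvexHull H u - β * u, β, ?_⟩
  filter_upwards [Icc_mem_nhds (show u < q by linarith) (show q < v by linarith)] with p hp
  have h1 : L p ≤ lowerConvexHull H p :=
    (le_max_right _ _).trans (le_lowerConvexHull (hG.sup hLconv) hmax (hin p hp).2.2)
  have h2 : lowerConvexHull H p ≤ L p := hG.le_chord hum.2.2 hvm.2.2 huv hp.1 hp.2
  rw [le_antisymm h2 h1]
  simp only [hL]; ring

/-- The right derivative of the lower convex hull. -/
noncomputable def hullSlope (H : ℝ → ℝ) (q : ℝ) : ℝ :=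
  derivWithin (lowerConvexHull H) (Set.Ioi q) q

theorem hasDerivWithinAt_lowerConvexHull (hH : ∀ q ∈ Set.Icc (0 : ℝ) 1, 0 ≤ H q) {q : ℝ}
    (hq : q ∈ Set.Ioo (0 : ℝ) 1) :
    HasDerivWithinAt (lowerConvexHull H) (hullSlope H q) (Set.Ioi q) q :=
  (convexOn_lowerConvexHull hH).hasDerivWithinAt_rightDeriv_of_mem_interior
    (by rwa [interior_Icc])

theorem hullSlope_nonneg_of_pos (hH : ∀ q ∈ Set.Icc (0 : ℝ) 1, 0 ≤ H q) (h0 : H 0 = 0) {q : ℝ}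
    (hq : q ∈ Set.Ioo (0 : ℝ) 1) : 0 ≤ hullSlope H q := by
  have hG := convexOn_lowerConvexHull hH
  have hz := lowerConvexHull_zero hH h0
  refine ge_of_tendsto (hasDerivWithinAt_iff_tendsto_slope' Set.self_notMem_Ioi |>.1
    (hasDerivWithinAt_lowerConvexHull hH hq)) ?_
  filter_upwards [Ioo_mem_nhdsGT hq.2] with p hp
  have h1 := hG.slope_mono_adjacent (x := 0) (y := q) (z := p) (by simp)
    ⟨hq.1.le.trans hp.1.le, hp.2.le⟩ hq.1 hp.1
  rw [slope_def_field]
  refine le_trans ?_ h1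
  rw [hz, sub_zero, sub_zero]
  exact div_nonneg (lowerConvexHull_nonneg hH ⟨hq.1.le, hq.2.le⟩) hq.1.le

/-- At the end point there are two cases: a right derivative is bounded by the slopes to its right,
and otherwise `derivWithin` is `0` by default, below every interior slope. -/
theorem hullSlope_zero_le (hH : ∀ q ∈ Set.Icc (0 : ℝ) 1, 0 ≤ H q) (h0 : H 0 = 0) {q : ℝ}
    (hq : q ∈ Set.Ioo (0 : ℝ) 1) : hullSlope H 0 ≤ hullSlope H q := by
  by_cases hd : DifferentiableWithinAt ℝ (lowerConvexHull H) (Set.Ioi 0) 0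
  · have hG := convexOn_lowerConvexHull hH
    have h1 := hG.rightDeriv_le_slope (x := 0) (y := q) (by simp) ⟨hq.1.le, hq.2.le⟩ hq.1 hd
    refine h1.trans ?_
    refine ge_of_tendsto (hasDerivWithinAt_iff_tendsto_slope' Set.self_notMem_Ioi |>.1
      (hasDerivWithinAt_lowerConvexHull hH hq)) ?_
    filter_upwards [Ioo_mem_nhdsGT hq.2] with p hp
    have h2 := hG.slope_mono_adjacent (x := 0) (y := q) (z := p) (by simp)
      ⟨hq.1.le.trans hp.1.le, hp.2.le⟩ hq.1 hp.1
    rw [slope_def_field, slope_def_field]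
    exact h2
  · rw [hullSlope, derivWithin_zero_of_not_differentiableWithinAt hd]
    exact hullSlope_nonneg_of_pos hH h0 hq

theorem monotoneOn_hullSlope (hH : ∀ q ∈ Set.Icc (0 : ℝ) 1, 0 ≤ H q) (h0 : H 0 = 0) :
    MonotoneOn (hullSlope H) (Set.Ico 0 1) := by
  intro p hp q hq hpq
  have h := (convexOn_lowerConvexHull hH).monotoneOn_rightDeriv
  rw [interior_Icc] at h
  rcases eq_or_lt_of_le hpq with rfl | hlt
  · exact le_rfl
  rcases eq_or_lt_of_le hp.1 with rfl | hp0
  · exact hullSlope_zero_le hH h0 ⟨hlt, hq.2⟩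
  · exact h ⟨hp0, hp.2⟩ ⟨hp0.trans hlt, hq.2⟩ hpq

theorem integrableOn_hullSlope (hH : ∀ q ∈ Set.Icc (0 : ℝ) 1, 0 ≤ H q) (h0 : H 0 = 0)
    (hc : ContinuousOn H (Set.Icc 0 1)) : IntegrableOn (hullSlope H) (Set.Icc 0 1) := by
  rw [integrableOn_Icc_iff_integrableOn_Ioc]
  exact intervalIntegral.integrableOn_deriv_right_of_nonneg
    (continuousOn_lowerConvexHull hH h0 hc)
    (fun q hq => hasDerivWithinAt_lowerConvexHull hH hq)
    (fun q hq => hullSlope_nonneg_of_pos hH h0 hq)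

theorem integral_hullSlope (hH : ∀ q ∈ Set.Icc (0 : ℝ) 1, 0 ≤ H q) (h0 : H 0 = 0)
    (hc : ContinuousOn H (Set.Icc 0 1)) {p q : ℝ} (hp : 0 ≤ p) (hpq : p ≤ q) (hq : q ≤ 1) :
    ∫ t in p..q, hullSlope H t = lowerConvexHull H q - lowerConvexHull H p := by
  have hsub : Set.Icc p q ⊆ Set.Icc 0 1 := Set.Icc_subset_Icc hp hq
  refine intervalIntegral.integral_eq_sub_of_hasDeriv_right_of_le hpq
    ((continuousOn_lowerConvexHull hH h0 hc).mono hsub)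
    (fun x hx => hasDerivWithinAt_lowerConvexHull hH ⟨hp.trans_lt hx.1, hx.2.trans_le hq⟩) ?_
  rw [intervalIntegrable_iff_integrableOn_Icc_of_le hpq]
  exact (integrableOn_hullSlope hH h0 hc).mono_set hsub

/-- The hull is affine near `q`. This is the source of the ties in the ironed virtual cost. -/
theorem hullSlope_eventually_const (hH : ∀ q ∈ Set.Icc (0 : ℝ) 1, 0 ≤ H q) (h0 : H 0 = 0)
    (hc : ContinuousOn H (Set.Icc 0 1)) {q : ℝ} (hq : q ∈ Set.Icc (0 : ℝ) 1)
    (hne : H q ≠ lowerConvexHull H q) :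
    ∀ᶠ p in 𝓝 q, hullSlope H p = hullSlope H q := by
  obtain ⟨-, α, β, h⟩ := lowerConvexHull_eventuallyEq_affine hH h0 hc hq hne
  have h1 : ∀ᶠ p in 𝓝 q, hullSlope H p = β := by
    filter_upwards [h.eventually_nhds] with p hp
    have hd : HasDerivAt (fun p => α + β * p) β p := by
      simpa using ((hasDerivAt_id p).const_mul β).const_add α
    exact ((hd.congr_of_eventuallyEq hp).hasDerivWithinAt).derivWithin
      (uniqueDiffWithinAt_Ioi p)
  filter_upwards [h1] with p hp
  rw [hp, h1.self_of_nhds]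

/-- The hull is affine on an interval on which it differs from the function. -/
theorem lowerConvexHull_eq_of_Ioo (hH : ∀ q ∈ Set.Icc (0 : ℝ) 1, 0 ≤ H q) (h0 : H 0 = 0)
    (hc : ContinuousOn H (Set.Icc 0 1)) {y z q : ℝ} (hy : 0 ≤ y) (hz : z ≤ 1)
    (hne : ∀ p ∈ Set.Ioo y z, H p ≠ lowerConvexHull H p) (hq : q ∈ Set.Ioo y z) :
    lowerConvexHull H q = lowerConvexHull H y + hullSlope H q * (q - y) ∧
      lowerConvexHull H z = lowerConvexHull H q + hullSlope H q * (z - q) := by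
  have hder : ∀ p ∈ Set.Ioo y z, HasDerivAt (hullSlope H) 0 p := by
    intro p hp
    have h := hullSlope_eventually_const hH h0 hc ⟨hy.trans hp.1.le, hp.2.le.trans hz⟩ (hne p hp)
    exact (hasDerivAt_const p (hullSlope H p)).congr_of_eventuallyEq h
  have hconst : ∀ p ∈ Set.Ioo y z, hullSlope H p = hullSlope H q := fun p hp =>
    isOpen_Ioo.is_const_of_deriv_eq_zero isPreconnected_Ioo
      (fun t ht => (hder t ht).differentiableAt.differentiableWithinAt)
      (fun t ht => (hder t ht).deriv) hp hq
  constructor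
  · have h1 := integral_hullSlope hH h0 hc hy hq.1.le (hq.2.le.trans hz)
    have h2 : ∫ t in y..q, hullSlope H t = ∫ _ in y..q, hullSlope H q := by
      rw [intervalIntegral.integral_of_le hq.1.le, intervalIntegral.integral_of_le hq.1.le]
      exact setIntegral_congr_fun measurableSet_Ioc fun t ht =>
        hconst t ⟨ht.1, ht.2.trans_lt hq.2⟩
    rw [h2, intervalIntegral.integral_const, smul_eq_mul] at h1
    linarith
  · have h1 := integral_hullSlope hH h0 hc (hy.trans hq.1.le) hq.2.le hz
    have h2 : ∫ t in q..z, hullSlope H t = ∫ _ in q..z, hullSlope H q := by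
      -- Half-open on the right, to avoid `z`, where the slope may jump.
      rw [intervalIntegral.integral_of_le hq.2.le, intervalIntegral.integral_of_le hq.2.le,
        ← integral_Ico_eq_integral_Ioc, ← integral_Ico_eq_integral_Ioc]
      exact setIntegral_congr_fun measurableSet_Ico fun t ht =>
        hconst t ⟨hq.1.trans_le ht.1, ht.2⟩
    rw [h2, intervalIntegral.integral_const, smul_eq_mul] at h1
    linarith

end LowerConvexHull

/-! ### Random sets of sellers -/

section Inclusion

variable {n : ℕ}

/-- The probability that the random set drawn from `p` contains `i`. -/
noncomputable def inclusionProb (p : PMF (Finset (Fin n))) (i : Fin n) : ℝ :=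
  ∑ W : Finset (Fin n), if i ∈ W then (p W).toReal else 0

theorem sum_toReal_pmf (p : PMF (Finset (Fin n))) : ∑ W, (p W).toReal = 1 := by
  rw [← ENNReal.toReal_sum fun W _ => p.apply_ne_top W, ← tsum_fintype (L := .unconditional _),
    p.tsum_coe, ENNReal.toReal_one]

theorem inclusionProb_nonneg (p : PMF (Finset (Fin n))) (i : Fin n) : 0 ≤ inclusionProb p i :=
  Finset.sum_nonneg fun W _ => by split_ifs <;> simp

theorem inclusionProb_le_one (p : PMF (Finset (Fin n))) (i : Fin n) : inclusionProb p i ≤ 1 := by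
  rw [← sum_toReal_pmf p]
  exact Finset.sum_le_sum fun W _ => by split_ifs <;> simp

theorem inclusionProb_eq_one {p : PMF (Finset (Fin n))} {i : Fin n}
    (h : ∀ W ∈ p.support, i ∈ W) : inclusionProb p i = 1 := by
  rw [← sum_toReal_pmf p]
  refine Finset.sum_congr rfl fun W _ => ?_
  by_cases hW : W ∈ p.support
  · rw [if_pos (h W hW)]
  · rw [(PMF.apply_eq_zero_iff p W).2 hW]; simp

theorem inclusionProb_eq_zero {p : PMF (Finset (Fin n))} {i : Fin n}
    (h : ∀ W ∈ p.support, i ∉ W) : inclusionProb p i = 0 := by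
  refine Finset.sum_eq_zero fun W _ => ?_
  by_cases hW : W ∈ p.support
  · rw [if_neg (h W hW)]
  · rw [(PMF.apply_eq_zero_iff p W).2 hW]; simp

/-- Linearity of expectation turns sums over marginals into averages over drawn sets, to which
exchange arguments apply. -/
theorem sum_inclusionProb_mul (p : PMF (Finset (Fin n))) (c : Fin n → ℝ) :
    ∑ i, inclusionProb p i * c i = ∑ W, (p W).toReal * ∑ i ∈ W, c i := by
  simp_rw [inclusionProb, Finset.sum_mul, Finset.mul_sum]
  rw [Finset.sum_comm]
  refine Finset.sum_congr rfl fun W _ => ?_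
  rw [← Finset.sum_filter_add_sum_filter_not Finset.univ (fun i => i ∈ W)]
  rw [Finset.sum_eq_zero (s := Finset.univ.filter fun i => i ∉ W), add_zero]
  · rw [Finset.filter_univ_mem]
    exact Finset.sum_congr rfl fun i hi => by rw [if_pos hi]
  · intro i hi
    rw [if_neg (Finset.mem_filter.1 hi).2, zero_mul]

theorem sum_inclusionProb {p : PMF (Finset (Fin n))} {w : ℕ}
    (h : ∀ W ∈ p.support, W.card = w) : ∑ i, inclusionProb p i = w := by
  have h1 := sum_inclusionProb_mul p fun _ => 1
  simp only [mul_one, Finset.sum_const, nsmul_eq_mul] at h1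
  rw [h1, ← one_mul (w : ℝ), ← sum_toReal_pmf p, Finset.sum_mul]
  refine Finset.sum_congr rfl fun W _ => ?_
  by_cases hW : W ∈ p.support
  · rw [h W hW]
  · rw [(PMF.apply_eq_zero_iff p W).2 hW]; simp

end Inclusion

/-! ### Cheapest sets -/

section Cheapest

variable {n w : ℕ}

theorem mem_cheapestSets {s : Fin n → EReal} {W : Finset (Fin n)} :
    W ∈ cheapestSets w s ↔ W.card = w ∧ ∀ i ∈ W, ∀ j ∉ W, s i ≤ s j := by
  simp [cheapestSets]

theorem exists_mem_notMem {V W : Finset (Fin n)} (h : V.card = W.card) {i : Fin n} (hW : i ∈ W)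
    (hV : i ∉ V) : ∃ k ∈ V, k ∉ W := by
  by_contra! hcon
  exact hV ((Finset.eq_of_subset_of_card_le hcon h.ge) ▸ hW)

/-- A seller who may sell at some score sells for certain at every lower score. -/
theorem mem_cheapestSets_of_lt {s : Fin n → EReal} {i : Fin n} {σ τ : EReal} (hστ : σ < τ)
    {W V : Finset (Fin n)} (hW : W ∈ cheapestSets w (Function.update s i τ)) (hi : i ∈ W)
    (hV : V ∈ cheapestSets w (Function.update s i σ)) : i ∈ V := by
  rw [mem_cheapestSets] at hW hV
  by_contra hiV
  -- If `i` were left out of `V`, some `k` would be in `V` but not in `W`; then `τ ≤ s k` by the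
  -- choice of `W` and `s k ≤ σ` by that of `V`.
  obtain ⟨k, hkV, hkW⟩ := exists_mem_notMem (hV.1.trans hW.1.symm) hi hiV
  have hki : k ≠ i := fun h => hiV (h ▸ hkV)
  have h1 := hW.2 i hi k hkW
  have h2 := hV.2 k hkV i hiV
  rw [Function.update_self, Function.update_of_ne hki] at h1 h2
  exact absurd (h1.trans h2) (not_le.2 hστ)

/-- Since `w < n`, some seller is left out; if `i` were bought, that seller would also have score
`⊤`. -/
theorem notMem_of_top {s : Fin n → EReal} {i : Fin n} (hwn : w < n) (hi : s i = ⊤)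
    (hj : ∀ j, j ≠ i → s j ≠ ⊤) {W : Finset (Fin n)} (hW : W ∈ cheapestSets w s) : i ∉ W := by
  intro hiW
  rw [mem_cheapestSets] at hW
  have hex : ∃ j, j ∉ W := by
    by_contra! h
    have : W = Finset.univ := Finset.eq_univ_iff_forall.2 h
    have hc := hW.1
    rw [this, Finset.card_univ, Fintype.card_fin] at hc
    omega
  obtain ⟨j, hjW⟩ := hex
  have h := hW.2 i hiW j hjW
  rw [hi, top_le_iff] at h
  exact hj j (fun h' => hjW (h' ▸ hiW)) h

/-- After the common part is cancelled, `W \ V` and `V \ W` have equal size and every cost in the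
first is at most every cost in the second. -/
theorem sum_le_sum_of_cheapest {c : Fin n → ℝ} {W V : Finset (Fin n)}
    (hW : W ∈ cheapestSets w fun i => (c i : EReal)) (hV : V.card = w) :
    ∑ i ∈ W, c i ≤ ∑ i ∈ V, c i := by
  rw [mem_cheapestSets] at hW
  have hcard : (W \ V).card = (V \ W).card := Finset.card_sdiff_comm (hW.1.trans hV.symm)
  rw [← Finset.sum_inter_add_sum_sdiff W V, ← Finset.sum_inter_add_sum_sdiff V W,
    Finset.inter_comm V W]
  refine add_le_add le_rfl ?_
  rcases (W \ V).eq_empty_or_nonempty with he | hne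
  · have : V \ W = ∅ := by rw [← Finset.card_eq_zero, ← hcard, he, Finset.card_empty]
    rw [he, this]
  · obtain ⟨m, hm, hmax⟩ := Finset.exists_max_image (W \ V) c hne
    refine (Finset.sum_le_card_nsmul _ _ (c m) hmax).trans ?_
    rw [hcard]
    refine Finset.card_nsmul_le_sum _ _ _ fun j hj => ?_
    rw [Finset.mem_sdiff] at hm hj
    exact EReal.coe_le_coe_iff.1 (hW.2 m hm.1 j hj.2)

/-- Both averages are compared with the total over one fixed cheapest set. -/
theorem sum_inclusionProb_mul_le {c : Fin n → ℝ} {p p' : PMF (Finset (Fin n))}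
    (hp : ∀ W ∈ p.support, W ∈ cheapestSets w fun i => (c i : EReal))
    (hp' : ∀ W ∈ p'.support, W.card = w) :
    ∑ i, inclusionProb p i * c i ≤ ∑ i, inclusionProb p' i * c i := by
  rw [sum_inclusionProb_mul, sum_inclusionProb_mul]
  obtain ⟨W₀, hW₀⟩ := p.support_nonempty
  have h1 : ∑ W, (p W).toReal * ∑ i ∈ W, c i ≤ ∑ W, (p W).toReal * ∑ i ∈ W₀, c i := by
    refine Finset.sum_le_sum fun W _ => ?_
    by_cases hW : W ∈ p.support
    · exact mul_le_mul_of_nonneg_left (sum_le_sum_of_cheapest (hp W hW)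
        (mem_cheapestSets.1 (hp W₀ hW₀)).1) ENNReal.toReal_nonneg
    · rw [(PMF.apply_eq_zero_iff p W).2 hW]; simp
  have h2 : ∑ W, (p' W).toReal * ∑ i ∈ W₀, c i ≤ ∑ W, (p' W).toReal * ∑ i ∈ W, c i := by
    refine Finset.sum_le_sum fun W _ => ?_
    by_cases hW : W ∈ p'.support
    · exact mul_le_mul_of_nonneg_left (sum_le_sum_of_cheapest (hp W₀ hW₀) (hp' W hW))
        ENNReal.toReal_nonneg
    · rw [(PMF.apply_eq_zero_iff p' W).2 hW]; simp
  rw [← Finset.sum_mul, sum_toReal_pmf] at h1 h2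
  exact h1.trans h2

/-- The uniform lottery over the cheapest sets. -/
noncomputable def cheapestLottery (hw : w ≤ n) (s : Fin n → EReal) : PMF (Finset (Fin n)) :=
  PMF.uniformOfFinset (cheapestSets w s) (cheapestSets_nonempty w hw s)

theorem mem_support_cheapestLottery {hw : w ≤ n} {s : Fin n → EReal} {W : Finset (Fin n)} :
    W ∈ (cheapestLottery hw s).support ↔ W ∈ cheapestSets w s :=
  PMF.mem_support_uniformOfFinset_iff _ _

theorem inclusionProb_cheapestLottery_eq_one (hw : w ≤ n) (s : Fin n → EReal) (i : Fin n)
    {σ τ : EReal} (hστ : σ < τ)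
    (h : inclusionProb (cheapestLottery hw (Function.update s i τ)) i ≠ 0) :
    inclusionProb (cheapestLottery hw (Function.update s i σ)) i = 1 := by
  have hex : ∃ W ∈ (cheapestLottery hw (Function.update s i τ)).support, i ∈ W := by
    by_contra! hcon
    exact h (inclusionProb_eq_zero hcon)
  obtain ⟨W, hW, hi⟩ := hex
  exact inclusionProb_eq_one fun V hV => mem_cheapestSets_of_lt hστ
    (mem_support_cheapestLottery.1 hW) hi (mem_support_cheapestLottery.1 hV)

/-- When a score rises strictly, either the new probability is `0` or the old one was `1`. -/
theorem antitone_inclusionProb_cheapestLottery (hw : w ≤ n) (s : Fin n → EReal) (i : Fin n) :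
    Antitone fun τ => inclusionProb (cheapestLottery hw (Function.update s i τ)) i := by
  intro σ τ hστ
  rcases eq_or_lt_of_le hστ with rfl | hlt
  · exact le_rfl
  by_cases h : inclusionProb (cheapestLottery hw (Function.update s i τ)) i = 0
  · simp only [h]; exact inclusionProb_nonneg _ _
  · simp only [inclusionProb_cheapestLottery_eq_one hw s i hlt h]
    exact inclusionProb_le_one _ _

theorem inclusionProb_cheapestLottery_eq_zero {hw : w ≤ n} {s : Fin n → EReal} {i : Fin n}
    (hwn : w < n) (hi : s i = ⊤) (hj : ∀ j, j ≠ i → s j ≠ ⊤) :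
    inclusionProb (cheapestLottery hw s) i = 0 :=
  inclusionProb_eq_zero fun _ hW => notMem_of_top hwn hi hj (mem_support_cheapestLottery.1 hW)

/-- Each set is drawn with probability an indicator divided by the number of cheapest sets, and both
depend on finitely many comparisons of scores. -/
theorem measurable_inclusionProb_cheapestLottery {Ω : Type*} [MeasurableSpace Ω] (hw : w ≤ n)
    {S : Ω → Fin n → EReal} (hS : ∀ i, Measurable fun ω => S ω i) (i : Fin n) :
    Measurable fun ω => inclusionProb (cheapestLottery hw (S ω)) i := by
  have hset : ∀ W : Finset (Fin n), MeasurableSet {ω | W ∈ cheapestSets w (S ω)} := by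
    intro W
    simp only [mem_cheapestSets]
    refine (MeasurableSet.const _).inter ?_
    refine measurableSet_setOfPred.2 ?_
    refine Measurable.forall fun j => Measurable.imp measurable_const ?_
    refine Measurable.forall fun k => Measurable.imp measurable_const ?_
    exact measurableSet_setOfPred.1 (measurableSet_le (hS j) (hS k))
  have hcard : Measurable fun ω => ((cheapestSets w (S ω)).card : ℝ) := by
    have : (fun ω => ((cheapestSets w (S ω)).card : ℝ)) =
        fun ω => ∑ W : Finset (Fin n), {ω | W ∈ cheapestSets w (S ω)}.indicator (fun _ => 1) ω := by
      ext ω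
      simp [Set.indicator]
    rw [this]
    exact Finset.measurable_sum _ fun W _ => measurable_const.indicator (hset W)
  refine Finset.measurable_sum _ fun W _ => ?_
  by_cases hi : i ∈ W
  · simp only [if_pos hi]
    have : (fun ω => ((cheapestLottery hw (S ω)) W).toReal) =
        {ω | W ∈ cheapestSets w (S ω)}.indicator
          (fun ω => ((cheapestSets w (S ω)).card : ℝ)⁻¹) := by
      ext ω
      rw [cheapestLottery, PMF.uniformOfFinset_apply]
      by_cases h : W ∈ cheapestSets w (S ω)
      · simp [h]
      · simp [h]
    rw [this]
    exact hcard.inv.indicator (hset W)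
  · simp only [if_neg hi]
    exact measurable_const

end Cheapest

/-! ### Integrals against antitone functions -/

/-- Layer cake: write `X(z) = ∫₀^C 1_{y < X(z)} dy` and swap. The weight `k` may change sign. -/
theorem setIntegral_mul_eq_integral_superlevel {a b C : ℝ} {X k : ℝ → ℝ} (hX : Measurable X)
    (hX0 : ∀ z, 0 ≤ X z) (hXC : ∀ z, X z ≤ C) (hk : IntegrableOn k (Set.Icc a b)) :
    ∫ z in Set.Icc a b, X z * k z =
      ∫ y in Set.Ioc 0 C, ∫ z in Set.Icc a b ∩ {z | y < X z}, k z := by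
  have hset : MeasurableSet {p : ℝ × ℝ | p.2 < X p.1} :=
    measurableSet_lt measurable_snd (hX.comp measurable_fst)
  have hint : Integrable (fun p : ℝ × ℝ => {p : ℝ × ℝ | p.2 < X p.1}.indicator (fun p => k p.1) p)
      ((volume.restrict (Set.Icc a b)).prod (volume.restrict (Set.Ioc 0 C))) :=
    (Integrable.comp_fst hk _).indicator hset
  have h1 : ∀ z, X z * k z = ∫ y in Set.Ioc 0 C,
      {p : ℝ × ℝ | p.2 < X p.1}.indicator (fun p => k p.1) (z, y) := by
    intro z
    have h2 : (fun y => {p : ℝ × ℝ | p.2 < X p.1}.indicator (fun p => k p.1) (z, y)) =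
        (Set.Iio (X z)).indicator (fun _ => k z) := by
      ext y; simp [Set.indicator]
    have h3 : Set.Ioc 0 C ∩ Set.Iio (X z) = Set.Ioo 0 (X z) := by
      ext y; simp only [Set.mem_inter_iff, Set.mem_Ioc, Set.mem_Iio, Set.mem_Ioo]
      exact ⟨fun h => ⟨h.1.1, h.2⟩, fun h => ⟨⟨h.1, h.2.le.trans (hXC z)⟩, h.2⟩⟩
    rw [h2, setIntegral_indicator measurableSet_Iio, h3, setIntegral_const]
    simp [measureReal_def, ENNReal.toReal_ofReal (hX0 z)]
  simp_rw [h1]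
  rw [integral_integral_swap hint]
  refine integral_congr_ae (Eventually.of_forall fun y => ?_)
  have h2 : (fun z => {p : ℝ × ℝ | p.2 < X p.1}.indicator (fun p => k p.1) (z, y)) =
      {z | y < X z}.indicator k := by
    ext z; simp [Set.indicator]
  simp only [h2]
  exact setIntegral_indicator (measurableSet_lt measurable_const hX)

/-- A superlevel set of an antitone function is an initial segment; `c` is its supremum, or `a` if
it is empty. Whether `c` belongs to it is irrelevant for the integral. -/
theorem exists_setIntegral_superlevel_eq {a b : ℝ} (hab : a ≤ b) {X : ℝ → ℝ}
    (hanti : AntitoneOn X (Set.Icc a b)) (k : ℝ → ℝ) (y : ℝ) :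
    ∃ c ∈ Set.Icc a b, (∫ z in Set.Icc a b ∩ {z | y < X z}, k z = ∫ z in Set.Icc a c, k z) ∧
      (∀ z ∈ Set.Ico a c, y < X z) ∧ ∀ z ∈ Set.Ioc c b, X z ≤ y := by
  rcases (Set.Icc a b ∩ {z | y < X z}).eq_empty_or_nonempty with he | hne
  · refine ⟨a, ⟨le_rfl, hab⟩, by simp [he], by simp, fun z hz => ?_⟩
    by_contra h
    exact Set.eq_empty_iff_forall_notMem.1 he z ⟨⟨hz.1.le, hz.2⟩, not_le.1 h⟩
  set S := Set.Icc a b ∩ {z | y < X z} with hS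
  have hbdd : BddAbove S := ⟨b, fun z hz => hz.1.2⟩
  have hlt : ∀ z ∈ Set.Ico a (sSup S), z ∈ S := by
    intro z hz
    obtain ⟨t, ht, hzt⟩ := exists_lt_of_lt_csSup hne hz.2
    have hzI : z ∈ Set.Icc a b := ⟨hz.1, hzt.le.trans ht.1.2⟩
    exact ⟨hzI, lt_of_lt_of_le ht.2 (hanti hzI ht.1 hzt.le)⟩
  refine ⟨sSup S, ⟨?_, csSup_le hne fun z hz => hz.1.2⟩, ?_, fun z hz => (hlt z hz).2,
    fun z hz => ?_⟩
  · obtain ⟨t, ht⟩ := hne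
    exact ht.1.1.trans (le_csSup hbdd ht)
  · apply setIntegral_congr_set
    have h1 : S ≤ᵐ[volume] Set.Icc a (sSup S) :=
      Eventually.of_forall fun z hz => ⟨hz.1.1, le_csSup hbdd hz⟩
    have h2 : Set.Ico a (sSup S) ≤ᵐ[volume] S := Eventually.of_forall hlt
    exact h1.antisymm ((Ico_ae_eq_Icc (a := a) (b := sSup S)).symm.le.trans h2)
  · by_contra h
    have hzI : z ∈ Set.Icc a b := by
      refine ⟨?_, hz.2⟩
      obtain ⟨t, ht⟩ := hne
      exact (ht.1.1.trans (le_csSup hbdd ht)).trans hz.1.le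
    exact absurd (le_csSup hbdd ⟨hzI, not_le.1 h⟩) (not_le.2 hz.1)

/-! ### The real-valued ironed virtual cost -/

/-- The ironed virtual cost as a real number; it is meant for costs below the right end point. -/
noncomputable def ironedCost (μ : Measure ℝ) (f : ℝ → ℝ) (a b z : ℝ) : ℝ :=
  hullSlope (cumulativeVirtualCost μ f a b) (cdf μ z)

namespace HasPositiveDensity

variable {μ : Measure ℝ} [IsProbabilityMeasure μ] {f : ℝ → ℝ} {a b : ℝ}

theorem ironedVirtualCost_of_lt (hF : HasPositiveDensity μ f a b) {z : ℝ} (hz : z < b) :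
    ironedVirtualCost μ f a b z = (ironedCost μ f a b z : EReal) :=
  if_pos (hF.cdf_lt_one hz)

theorem ironedVirtualCost_of_ge (hF : HasPositiveDensity μ f a b) {z : ℝ} (hz : b ≤ z) :
    ironedVirtualCost μ f a b z = ⊤ :=
  if_neg (by rw [hF.cdf_of_ge hz]; exact lt_irrefl 1)

theorem monotone_ironedVirtualCost (hF : HasPositiveDensity μ f a b) :
    Monotone (ironedVirtualCost μ f a b) := by
  intro y z hyz
  rcases lt_or_ge z b with hz | hz
  · rw [hF.ironedVirtualCost_of_lt hz, hF.ironedVirtualCost_of_lt (hyz.trans_lt hz),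
      EReal.coe_le_coe_iff]
    exact monotoneOn_hullSlope hF.cumulativeVirtualCost_nonneg cumulativeVirtualCost_zero
      ⟨cdf_nonneg μ y, hF.cdf_lt_one (hyz.trans_lt hz)⟩ ⟨cdf_nonneg μ z, hF.cdf_lt_one hz⟩
      (monotone_cdf μ hyz)
  · rw [hF.ironedVirtualCost_of_ge hz]
    exact le_top

theorem integrableOn_hullSlope (hF : HasPositiveDensity μ f a b) :
    IntegrableOn (hullSlope (cumulativeVirtualCost μ f a b)) (Set.Icc 0 1) :=
  Procurement.integrableOn_hullSlope hF.cumulativeVirtualCost_nonneg cumulativeVirtualCost_zero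
    hF.continuousOn_cumulativeVirtualCost

theorem integrable_ironedCost (hF : HasPositiveDensity μ f a b) :
    Integrable (ironedCost μ f a b) μ := by
  have h := hF.integrableOn_hullSlope
  rw [IntegrableOn, ← hF.map_cdf] at h
  exact h.comp_measurable (monotone_cdf μ).measurable

/-- The counterpart for `G` of `setIntegral_mul_density_add_cdf`, which yields `H`. -/
theorem setIntegral_density_mul_ironedCost (hF : HasPositiveDensity μ f a b) {c : ℝ}
    (hc : c ∈ Set.Icc a b) :
    ∫ z in Set.Icc a c, f z * ironedCost μ f a b z = ironedCumulative μ f a b (cdf μ c) := by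
  have h := integral_hullSlope hF.cumulativeVirtualCost_nonneg cumulativeVirtualCost_zero
    hF.continuousOn_cumulativeVirtualCost le_rfl (cdf_nonneg μ c) (cdf_le_one μ c)
  rw [lowerConvexHull_zero hF.cumulativeVirtualCost_nonneg cumulativeVirtualCost_zero, sub_zero,
    ← hF.setIntegral_density_mul_comp_cdf hF.integrableOn_hullSlope.aestronglyMeasurable hc] at h
  exact h

/-- The expected payment of an antitone threshold rule exceeds its expected ironed virtual cost by
the average gap between the revenue curve and its hull at the ends of the superlevel sets. -/
theorem integral_payment_sub (hF : HasPositiveDensity μ f a b) {X : ℝ → ℝ} (hX : Measurable X)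
    (hX0 : ∀ z, 0 ≤ X z) (hX1 : ∀ z, X z ≤ 1) (hanti : AntitoneOn X (Set.Icc a b)) :
    ∃ c : ℝ → ℝ, (∀ y, c y ∈ Set.Icc a b ∧ (∀ z ∈ Set.Ico a (c y), y < X z) ∧
      ∀ z ∈ Set.Ioc (c y) b, X z ≤ y) ∧
    ∫ z, (z * X z + ∫ s in Set.Ioc z b, X s) ∂μ - ∫ z, X z * ironedCost μ f a b z ∂μ =
      ∫ y in Set.Ioc 0 1, (cumulativeVirtualCost μ f a b (cdf μ (c y)) -
        ironedCumulative μ f a b (cdf μ (c y))) := by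
  have hC : ∀ z ∈ Set.Icc a b, |X z| ≤ 1 := fun z _ => by
    rw [abs_of_nonneg (hX0 z)]; exact hX1 z
  have hγ := (hF.integrable_iff _).1 hF.integrable_ironedCost
  have h1 : IntegrableOn (fun z => z * f z + cdf μ z) (Set.Icc a b) := by
    simpa using hF.integrableOn_mul_density_add_cdf (X := fun _ => 1) (C := 1) measurable_const
      (by simp)
  -- The virtual minus the ironed cost, weighted by the density; over `[a, c]` it integrates to `(H
  -- - G)(F(c))`.
  set k : ℝ → ℝ := fun z => (z * f z + cdf μ z) - f z * ironedCost μ f a b z with hk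
  have hkint : IntegrableOn k (Set.Icc a b) := h1.sub hγ
  choose c hc1 hc2 hc3 hc4 using exists_setIntegral_superlevel_eq hF.lt.le hanti k
  refine ⟨c, fun y => ⟨hc1 y, hc3 y, hc4 y⟩, ?_⟩
  have h2 : Integrable (fun z => X z * ironedCost μ f a b z) μ :=
    hF.integrable_ironedCost.bdd_mul hX.aestronglyMeasurable
      (Eventually.of_forall fun z => by
        rw [Real.norm_eq_abs, abs_of_nonneg (hX0 z)]; exact hX1 z)
  have h3 := (hF.integrable_iff _).1 h2
  rw [(hF.integral_payment hX hC).2, hF.integral_eq (fun z => X z * ironedCost μ f a b z),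
    ← integral_sub (hF.integrableOn_mul_density_add_cdf hX hC) h3]
  have h4 : ∀ z, X z * (z * f z + cdf μ z) - f z * (X z * ironedCost μ f a b z) = X z * k z := by
    intro z; simp only [hk]; ring
  simp_rw [h4]
  rw [setIntegral_mul_eq_integral_superlevel hX hX0 hX1 hkint]
  refine integral_congr_ae (Eventually.of_forall fun y => ?_)
  have hsub : Set.Icc a (c y) ⊆ Set.Icc a b := Set.Icc_subset_Icc le_rfl (hc1 y).2
  simp only [hc2]
  rw [integral_sub (h1.mono_set hsub) (hγ.mono_set hsub),
    hF.setIntegral_mul_density_add_cdf (hc1 y), hF.setIntegral_density_mul_ironedCost (hc1 y),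
    hF.cumulativeVirtualCost_cdf (hc1 y)]

theorem integral_mul_ironedCost_le (hF : HasPositiveDensity μ f a b) {X : ℝ → ℝ}
    (hX : Measurable X) (hX0 : ∀ z, 0 ≤ X z) (hX1 : ∀ z, X z ≤ 1)
    (hanti : AntitoneOn X (Set.Icc a b)) :
    ∫ z, X z * ironedCost μ f a b z ∂μ ≤ ∫ z, (z * X z + ∫ s in Set.Ioc z b, X s) ∂μ := by
  obtain ⟨c, -, h⟩ := hF.integral_payment_sub hX hX0 hX1 hanti
  rw [← sub_nonneg, h]
  refine integral_nonneg fun y => sub_nonneg.2 ?_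
  exact lowerConvexHull_le hF.cumulativeVirtualCost_nonneg ⟨cdf_nonneg μ _, cdf_le_one μ _⟩

/-- If `H ≠ G` at `F(c_y)`, the ironed cost is constant near `c_y`, so `X` takes equal values on
both sides. But `X > y` on the left of `c_y` and `X ≤ y` on the right. -/
theorem integral_mul_ironedCost_eq (hF : HasPositiveDensity μ f a b) {X : ℝ → ℝ}
    (hX : Measurable X) (hX0 : ∀ z, 0 ≤ X z) (hX1 : ∀ z, X z ≤ 1)
    (hanti : AntitoneOn X (Set.Icc a b))
    (hconst : ∀ y z, y < b → z < b → ironedCost μ f a b y = ironedCost μ f a b z → X y = X z) :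
    ∫ z, X z * ironedCost μ f a b z ∂μ = ∫ z, (z * X z + ∫ s in Set.Ioc z b, X s) ∂μ := by
  obtain ⟨c, hc, h⟩ := hF.integral_payment_sub hX hX0 hX1 hanti
  rw [eq_comm, ← sub_eq_zero, h]
  refine integral_eq_zero_of_ae (Eventually.of_forall fun y => ?_)
  obtain ⟨hcI, hlt, hgt⟩ := hc y
  by_contra hne
  have hne' : cumulativeVirtualCost μ f a b (cdf μ (c y)) ≠
      lowerConvexHull (cumulativeVirtualCost μ f a b) (cdf μ (c y)) := fun h' =>
    hne (sub_eq_zero.2 h')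
  have hq : cdf μ (c y) ∈ Set.Icc (0 : ℝ) 1 := ⟨cdf_nonneg μ _, cdf_le_one μ _⟩
  have hH := hF.cumulativeVirtualCost_nonneg
  have hH0 : cumulativeVirtualCost μ f a b 0 = 0 := cumulativeVirtualCost_zero
  have hHc := hF.continuousOn_cumulativeVirtualCost
  have hIoo := (lowerConvexHull_eventuallyEq_affine hH hH0 hHc hq hne').1
  have hca : a < c y := by
    by_contra hle
    rw [hF.cdf_of_le (not_lt.1 hle)] at hIoo
    exact lt_irrefl _ hIoo.1
  have hcb : c y < b := by
    by_contra hle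
    rw [hF.cdf_of_ge (not_lt.1 hle)] at hIoo
    exact lt_irrefl _ hIoo.2
  have hev := (hF.continuous_cdf.tendsto (c y)).eventually
    (hullSlope_eventually_const hH hH0 hHc hq hne')
  obtain ⟨ε, hε, hball⟩ := Metric.eventually_nhds_iff.1
    (hev.and (Ioo_mem_nhds hca hcb))
  have h1 := hball (y := c y - ε / 2) (by rw [Real.dist_eq, abs_lt]; constructor <;> linarith)
  have h2 := hball (y := c y + ε / 2) (by rw [Real.dist_eq, abs_lt]; constructor <;> linarith)
  have h3 := hlt _ ⟨h1.2.1.le, by linarith⟩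
  have h4 := hgt _ ⟨by linarith, h2.2.2.le⟩
  have h5 := hconst _ _ h1.2.2 h2.2.2 (h1.1.trans h2.1.symm)
  linarith

end HasPositiveDensity

/-! ### Independent profiles -/

section Profiles

variable {n : ℕ} {μ : Measure ℝ} [IsProbabilityMeasure μ]

/-- Replacing one coordinate of an independent profile by an independent copy. -/
theorem measurePreserving_update (i : Fin n) :
    MeasurePreserving (fun p : (Fin n → ℝ) × ℝ => Function.update p.1 i p.2)
      ((Measure.pi fun _ => μ).prod μ) (Measure.pi fun _ => μ) := by
  refine ⟨measurable_update', (Measure.pi_eq fun s hs => ?_).symm⟩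
  rw [Measure.map_apply measurable_update' (MeasurableSet.univ_pi hs)]
  have h : (fun p : (Fin n → ℝ) × ℝ => Function.update p.1 i p.2) ⁻¹' Set.univ.pi s =
      (Set.univ.pi (Function.update s i Set.univ)) ×ˢ s i := by
    ext p
    simp only [Set.mem_preimage, Set.mem_pi, Set.mem_univ, true_imp_iff, Set.mem_prod]
    constructor
    · intro hp
      refine ⟨fun j => ?_, by simpa using hp i⟩
      by_cases hj : j = i
      · subst hj; simp
      · simpa [hj] using hp j
    · rintro ⟨h1, h2⟩ j
      by_cases hj : j = i
      · subst hj; simpa using h2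
      · simpa [hj] using h1 j
  rw [h, Measure.prod_prod, Measure.pi_pi, ← Finset.prod_erase_mul _ _ (Finset.mem_univ i),
    ← Finset.prod_erase_mul _ (fun j => μ (s j)) (Finset.mem_univ i)]
  congr 1
  rw [Function.update_self, measure_univ, mul_one]
  exact Finset.prod_congr rfl fun j hj => by rw [Function.update_of_ne (Finset.ne_of_mem_erase hj)]

/-- Reduces an expectation over profiles to an integral of interim quantities over the cost of
seller `i` alone. -/
theorem integral_pi_eq_integral_update (i : Fin n) {g : (Fin n → ℝ) → ℝ}
    (hg : Integrable g (Measure.pi fun _ => μ)) :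
    Integrable (fun t => ∫ v, g (Function.update v i t) ∂(Measure.pi fun _ => μ)) μ ∧
    ∫ v, g v ∂(Measure.pi fun _ => μ) =
      ∫ t, ∫ v, g (Function.update v i t) ∂(Measure.pi fun _ => μ) ∂μ := by
  have hmp := measurePreserving_update (μ := μ) i
  have hint : Integrable (fun p : (Fin n → ℝ) × ℝ => g (Function.update p.1 i p.2))
      ((Measure.pi fun _ => μ).prod μ) := hmp.integrable_comp_of_integrable hg
  refine ⟨hint.integral_prod_right, ?_⟩
  rw [← integral_prod_symm _ hint]
  rw [← hmp.map_eq] at hg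
  conv_lhs => rw [← hmp.map_eq]
  exact integral_map hmp.measurable.aemeasurable hg.aestronglyMeasurable

theorem HasPositiveDensity.ae_pi_mem {f : ℝ → ℝ} {a b : ℝ} (hF : HasPositiveDensity μ f a b) :
    ∀ᵐ v ∂(Measure.pi fun _ : Fin n => μ), ∀ i, v i ∈ Set.Ico a b :=
  ae_all_iff.2 fun i => (Measure.quasiMeasurePreserving_eval (fun _ : Fin n => μ) i).ae hF.ae_mem

end Profiles

/-! ### Interim purchase probabilities -/

namespace DirectMechanism

variable {n : ℕ} {μ : Measure ℝ} [IsProbabilityMeasure μ] {M : DirectMechanism n}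

theorem buyProb_nonneg (M : DirectMechanism n) (v : Fin n → ℝ) (i : Fin n) : 0 ≤ M.buyProb v i :=
  inclusionProb_nonneg _ _

theorem buyProb_le_one (M : DirectMechanism n) (v : Fin n → ℝ) (i : Fin n) : M.buyProb v i ≤ 1 :=
  inclusionProb_le_one _ _

theorem norm_buyProb_le_one (M : DirectMechanism n) (v : Fin n → ℝ) (i : Fin n) :
    ‖M.buyProb v i‖ ≤ 1 := by
  rw [Real.norm_eq_abs, abs_of_nonneg (M.buyProb_nonneg v i)]
  exact M.buyProb_le_one v i

variable {i : Fin n}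

theorem integrable_buyProb_update (hM : Measurable fun v => M.buyProb v i) (t : ℝ) :
    Integrable (fun v => M.buyProb (Function.update v i t) i) (Measure.pi fun _ => μ) :=
  Integrable.of_bound (hM.comp (measurable_update'.comp
    (measurable_id.prodMk measurable_const))).aestronglyMeasurable 1
    (Eventually.of_forall fun _ => M.norm_buyProb_le_one _ _)

theorem measurable_interimBuyProb (hM : Measurable fun v => M.buyProb v i) :
    Measurable (M.interimBuyProb μ i) := by
  have h : Measurable fun p : ℝ × (Fin n → ℝ) => M.buyProb (Function.update p.2 i p.1) i :=
    hM.comp (measurable_update'.comp measurable_swap)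
  exact (h.stronglyMeasurable.integral_prod_right).measurable

theorem interimBuyProb_nonneg {μ : Measure ℝ} (t : ℝ) : 0 ≤ M.interimBuyProb μ i t :=
  integral_nonneg fun _ => M.buyProb_nonneg _ _

theorem interimBuyProb_le_one (hM : Measurable fun v => M.buyProb v i) (t : ℝ) :
    M.interimBuyProb μ i t ≤ 1 := by
  have h := integral_mono (integrable_buyProb_update (μ := μ) hM t) (integrable_const 1)
    fun v => M.buyProb_le_one (Function.update v i t) i
  rw [integral_const, probReal_univ, one_smul] at h
  exact h

theorem integral_buyProb_mul (hM : Measurable fun v => M.buyProb v i) {γ : ℝ → ℝ}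
    (hγ : Integrable γ μ) :
    Integrable (fun v => M.buyProb v i * γ (v i)) (Measure.pi fun _ => μ) ∧
    ∫ v, M.buyProb v i * γ (v i) ∂(Measure.pi fun _ => μ) =
      ∫ t, M.interimBuyProb μ i t * γ t ∂μ := by
  have h1 : Integrable (fun v : Fin n → ℝ => γ (v i)) (Measure.pi fun _ => μ) :=
    (measurePreserving_eval (fun _ : Fin n => μ) i).integrable_comp_of_integrable hγ
  have h2 : Integrable (fun v => M.buyProb v i * γ (v i)) (Measure.pi fun _ => μ) :=
    h1.bdd_mul hM.aestronglyMeasurable (Eventually.of_forall fun v => M.norm_buyProb_le_one v i)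
  refine ⟨h2, ?_⟩
  rw [(integral_pi_eq_integral_update i h2).2]
  refine integral_congr_ae (Eventually.of_forall fun t => ?_)
  simp only [Function.update_self]
  exact integral_mul_const _ _

end DirectMechanism

/-! ### The mechanism that buys at the lowest ironed virtual costs -/

namespace HasPositiveDensity

variable {μ : Measure ℝ} [IsProbabilityMeasure μ] {f : ℝ → ℝ} {a b : ℝ} {n w : ℕ}

theorem ironedBuyProb_update {μ : Measure ℝ} (hw : w ≤ n) (v : Fin n → ℝ) (i : Fin n) (t : ℝ) :
    ironedBuyProb μ f a b hw (Function.update v i t) i =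
      inclusionProb (cheapestLottery hw (Function.update
        (fun j => ironedVirtualCost μ f a b (v j)) i (ironedVirtualCost μ f a b t))) i := by
  change inclusionProb (cheapestLottery hw
    (fun j => ironedVirtualCost μ f a b (Function.update v i t j))) i = _
  congr 2
  ext j
  by_cases hj : j = i
  · subst hj; simp
  · simp [hj]

theorem antitone_ironedBuyProb (hF : HasPositiveDensity μ f a b) (hw : w ≤ n) (v : Fin n → ℝ)
    (i : Fin n) : Antitone fun t => ironedBuyProb μ f a b hw (Function.update v i t) i := by
  intro s t hst
  simp only [ironedBuyProb_update]
  exact antitone_inclusionProb_cheapestLottery hw _ i (hF.monotone_ironedVirtualCost hst)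

/-- A report of at least `b` has score `⊤` while the others' scores are real. This cuts the payment
integral off at `b`. -/
theorem ironedBuyProb_eq_zero (hF : HasPositiveDensity μ f a b) (hwn : w < n) {v : Fin n → ℝ}
    (hv : ∀ j, v j < b) (i : Fin n) {t : ℝ} (ht : b ≤ t) :
    ironedBuyProb μ f a b hwn.le (Function.update v i t) i = 0 := by
  rw [ironedBuyProb_update]
  refine inclusionProb_cheapestLottery_eq_zero hwn ?_ fun j hj => ?_
  · rw [Function.update_self, hF.ironedVirtualCost_of_ge ht]
  · rw [Function.update_of_ne hj, hF.ironedVirtualCost_of_lt (hv j)]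
    exact EReal.coe_ne_top _

theorem measurable_ironedBuyProb (hF : HasPositiveDensity μ f a b) (hw : w ≤ n) (i : Fin n) :
    Measurable fun v => ironedBuyProb μ f a b hw v i := by
  have h : ∀ j, Measurable fun v : Fin n → ℝ => ironedVirtualCost μ f a b (v j) := fun j =>
    hF.monotone_ironedVirtualCost.measurable.comp (measurable_pi_apply j)
  exact measurable_inclusionProb_cheapestLottery hw h i

theorem measurable_buyProb_ironedMechanism (hF : HasPositiveDensity μ f a b) (hw : w ≤ n)
    (i : Fin n) : Measurable fun v => (ironedMechanism μ f a b hw).buyProb v i :=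
  hF.measurable_ironedBuyProb hw i

theorem ironedBuyProb_mem {μ : Measure ℝ} (hw : w ≤ n) (v : Fin n → ℝ) (i : Fin n) :
    ironedBuyProb μ f a b hw v i ∈ Set.Icc (0 : ℝ) 1 :=
  ⟨inclusionProb_nonneg _ _, inclusionProb_le_one _ _⟩

theorem integrableOn_ironedBuyProb (hF : HasPositiveDensity μ f a b) (hwn : w < n) {v : Fin n → ℝ}
    (hv : ∀ j, v j < b) (i : Fin n) (t : ℝ) :
    IntegrableOn (fun s => ironedBuyProb μ f a b hwn.le (Function.update v i s) i) (Set.Ioi t) := by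
  have h1 : IntegrableOn (fun s => ironedBuyProb μ f a b hwn.le (Function.update v i s) i)
      (Set.Ioc t b) :=
    Measure.integrableOn_of_bounded (M := 1) (by simp)
      (hF.antitone_ironedBuyProb hwn.le v i).measurable.aestronglyMeasurable
      (Eventually.of_forall fun s => by
        rw [Real.norm_eq_abs, abs_of_nonneg (ironedBuyProb_mem hwn.le _ i).1]
        exact (ironedBuyProb_mem hwn.le _ i).2)
  have h2 : IntegrableOn (fun s => ironedBuyProb μ f a b hwn.le (Function.update v i s) i)
      (Set.Ioi b) :=
    integrableOn_zero.congr_fun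
      (fun s hs => (hF.ironedBuyProb_eq_zero hwn hv i (Set.mem_Ioi.1 hs).le).symm) measurableSet_Ioi
  refine (h1.union h2).mono_set fun s hs => ?_
  rcases le_or_gt s b with h | h
  · exact Or.inl ⟨hs, h⟩
  · exact Or.inr h

theorem setIntegral_ironedBuyProb (hF : HasPositiveDensity μ f a b) (hwn : w < n) {v : Fin n → ℝ}
    (hv : ∀ j, v j < b) (i : Fin n) (t : ℝ) :
    ∫ s in Set.Ioi t, ironedBuyProb μ f a b hwn.le (Function.update v i s) i =
      ∫ s in Set.Ioc t b, ironedBuyProb μ f a b hwn.le (Function.update v i s) i := by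
  refine setIntegral_eq_of_subset_of_forall_sdiff_eq_zero measurableSet_Ioi
    Set.Ioc_subset_Ioi_self fun s hs => hF.ironedBuyProb_eq_zero hwn hv i ?_
  by_contra h
  exact hs.2 ⟨hs.1, (not_le.1 h).le⟩

theorem norm_setIntegral_ironedBuyProb_le {μ : Measure ℝ} (hw : w ≤ n) (v : Fin n → ℝ) (i : Fin n) (t : ℝ) :
    ‖∫ s in Set.Ioc t b, ironedBuyProb μ f a b hw (Function.update v i s) i‖ ≤ max (b - t) 0 := by
  have h := norm_setIntegral_le_of_norm_le_const (μ := volume) (s := Set.Ioc t b) (C := 1)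
    (f := fun s => ironedBuyProb μ f a b hw (Function.update v i s) i) (by simp)
    (fun s _ => by
      rw [Real.norm_eq_abs, abs_of_nonneg (ironedBuyProb_mem hw _ i).1]
      exact (ironedBuyProb_mem hw _ i).2)
  simpa using h

theorem ironedMechanism_pay_update {μ : Measure ℝ} (hw : w ≤ n) (v : Fin n → ℝ) (i : Fin n) (t : ℝ) :
    (ironedMechanism μ f a b hw).pay (Function.update v i t) i =
      t * ironedBuyProb μ f a b hw (Function.update v i t) i +
        ∫ s in Set.Ioi t, ironedBuyProb μ f a b hw (Function.update v i s) i := by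
  simp [ironedMechanism]

theorem norm_ironedMechanism_pay_update_le (hF : HasPositiveDensity μ f a b) (hwn : w < n)
    {v : Fin n → ℝ} (hv : ∀ j, v j < b) (i : Fin n) (t : ℝ) :
    ‖(ironedMechanism μ f a b hwn.le).pay (Function.update v i t) i‖ ≤ |t| + max (b - t) 0 := by
  rw [ironedMechanism_pay_update, hF.setIntegral_ironedBuyProb hwn hv]
  refine (norm_add_le _ _).trans (add_le_add ?_ (norm_setIntegral_ironedBuyProb_le hwn.le v i t))
  have h := ironedBuyProb_mem (μ := μ) (f := f) (a := a) (b := b) hwn.le (Function.update v i t) i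
  rw [norm_mul, Real.norm_eq_abs, Real.norm_eq_abs, abs_of_nonneg h.1]
  exact mul_le_of_le_one_right (abs_nonneg t) h.2

theorem measurable_ironedMechanism_pay (hF : HasPositiveDensity μ f a b) (hw : w ≤ n) (i : Fin n) :
    Measurable fun v => (ironedMechanism μ f a b hw).pay v i := by
  have h1 : Measurable fun p : (Fin n → ℝ) × ℝ =>
      ironedBuyProb μ f a b hw (Function.update p.1 i p.2) i :=
    (hF.measurable_ironedBuyProb hw i).comp measurable_update'
  have h2 : Measurable fun p : (Fin n → ℝ) × ℝ => {p : (Fin n → ℝ) × ℝ | p.1 i < p.2}.indicator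
      (fun p => ironedBuyProb μ f a b hw (Function.update p.1 i p.2) i) p :=
    h1.indicator (measurableSet_lt ((measurable_pi_apply i).comp measurable_fst) measurable_snd)
  have h3 : Measurable fun v : Fin n → ℝ =>
      ∫ t in Set.Ioi (v i), ironedBuyProb μ f a b hw (Function.update v i t) i := by
    have h4 := (h2.stronglyMeasurable.integral_prod_right' (ν := (volume : Measure ℝ))).measurable
    convert h4 using 2 with v
    rw [← integral_indicator measurableSet_Ioi]
    rfl
  exact ((measurable_pi_apply i).mul (hF.measurable_ironedBuyProb hw i)).add h3

theorem integrable_ironedMechanism_pay_update (hF : HasPositiveDensity μ f a b) (hwn : w < n)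
    (i : Fin n) (t : ℝ) :
    Integrable (fun v => (ironedMechanism μ f a b hwn.le).pay (Function.update v i t) i)
      (Measure.pi fun _ => μ) := by
  refine Integrable.of_bound ((hF.measurable_ironedMechanism_pay hwn.le i).comp
    (measurable_update'.comp (measurable_id.prodMk measurable_const))).aestronglyMeasurable
    (|t| + max (b - t) 0) ?_
  filter_upwards [hF.ae_pi_mem] with v hv
  exact hF.norm_ironedMechanism_pay_update_le hwn (fun j => (hv j).2) i t

theorem integrable_ironedMechanism_pay (hF : HasPositiveDensity μ f a b) (hwn : w < n)
    (i : Fin n) :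
    Integrable (fun v => (ironedMechanism μ f a b hwn.le).pay v i) (Measure.pi fun _ => μ) := by
  refine Integrable.of_bound (hF.measurable_ironedMechanism_pay hwn.le i).aestronglyMeasurable
    (b + b) ?_
  filter_upwards [hF.ae_pi_mem] with v hv
  have h := hF.norm_ironedMechanism_pay_update_le hwn (fun j => (hv j).2) i (v i)
  rw [Function.update_eq_self] at h
  have h1 := hF.nonneg.trans (hv i).1
  refine h.trans (add_le_add ?_ (max_le (by linarith) hF.pos_right.le))
  rw [abs_of_nonneg h1]
  exact (hv i).2.le

theorem interimUtility_ironedMechanism (hF : HasPositiveDensity μ f a b) (hwn : w < n)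
    (i : Fin n) (c t : ℝ) :
    Integrable (fun v => (t - c) * ironedBuyProb μ f a b hwn.le (Function.update v i t) i +
        ∫ s in Set.Ioi t, ironedBuyProb μ f a b hwn.le (Function.update v i s) i)
        (Measure.pi fun _ => μ) ∧
    (ironedMechanism μ f a b hwn.le).interimUtility μ i c t =
      ∫ v, ((t - c) * ironedBuyProb μ f a b hwn.le (Function.update v i t) i +
        ∫ s in Set.Ioi t, ironedBuyProb μ f a b hwn.le (Function.update v i s) i)
        ∂(Measure.pi fun _ => μ) := by
  have h1 := hF.integrable_ironedMechanism_pay_update hwn i t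
  have h2 := (DirectMechanism.integrable_buyProb_update (μ := μ)
    (hF.measurable_buyProb_ironedMechanism hwn.le i) t).const_mul c
  have h3 : (fun v => (t - c) * ironedBuyProb μ f a b hwn.le (Function.update v i t) i +
        ∫ s in Set.Ioi t, ironedBuyProb μ f a b hwn.le (Function.update v i s) i) =
      fun v => (ironedMechanism μ f a b hwn.le).pay (Function.update v i t) i -
        c * (ironedMechanism μ f a b hwn.le).buyProb (Function.update v i t) i := by
    ext v
    rw [ironedMechanism_pay_update]
    change _ = _ - c * ironedBuyProb μ f a b hwn.le (Function.update v i t) i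
    ring
  rw [h3]
  refine ⟨h1.sub h2, ?_⟩
  rw [integral_sub h1 h2, integral_const_mul]
  rfl

/-- Misreporting does not pay against an antitone purchase probability with threshold payments. -/
theorem _root_.Antitone.threshold_utility_le {x : ℝ → ℝ} (hx : Antitone x)
    (hint : ∀ t, IntegrableOn x (Set.Ioi t)) (c t : ℝ) :
    (t - c) * x t + ∫ s in Set.Ioi t, x s ≤ ∫ s in Set.Ioi c, x s := by
  have hI : ∀ y z : ℝ, IntervalIntegrable x volume y z := fun y z => hx.intervalIntegrable
  -- In either order, the integral of `x` between `t` and `c` is compared with the rectangle of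
  -- height `x t`.
  rcases le_total t c with h | h
  · have h1 := intervalIntegral.integral_Ioi_sub_Ioi (hint t) h
    have h2 : ∫ s in t..c, x s ≤ ∫ _ in t..c, x t :=
      intervalIntegral.integral_mono_on h (hI t c) intervalIntegrable_const fun s hs => hx hs.1
    rw [intervalIntegral.integral_const, smul_eq_mul] at h2
    linarith
  · have h1 := intervalIntegral.integral_Ioi_sub_Ioi (hint c) h
    have h2 : ∫ _ in c..t, x t ≤ ∫ s in c..t, x s :=
      intervalIntegral.integral_mono_on h intervalIntegrable_const (hI c t) fun s hs => hx hs.2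
    rw [intervalIntegral.integral_const, smul_eq_mul] at h2
    linarith

theorem isBICProcurement_ironedMechanism (hF : HasPositiveDensity μ f a b) (hwn : w < n) :
    (ironedMechanism μ f a b hwn.le).IsBICProcurement μ w Set.univ where
  measurable_buyProb := hF.measurable_ironedBuyProb hwn.le
  measurable_pay := hF.measurable_ironedMechanism_pay hwn.le
  integrable_pay := hF.integrable_ironedMechanism_pay hwn
  integrable_interim := hF.integrable_ironedMechanism_pay_update hwn
  buys v _ W hW :=
    (mem_cheapestSets.1 (mem_support_cheapestLottery (hw := hwn.le).1 hW)).1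
  -- Truthfulness holds for almost every profile of the others and is then averaged.
  truthful i c _ t := by
    obtain ⟨h1, h2⟩ := hF.interimUtility_ironedMechanism hwn i c t
    obtain ⟨h3, h4⟩ := hF.interimUtility_ironedMechanism hwn i c c
    rw [h2, h4]
    refine integral_mono_ae h1 h3 ?_
    filter_upwards [hF.ae_pi_mem] with v hv
    rw [sub_self, zero_mul, zero_add]
    exact (hF.antitone_ironedBuyProb hwn.le v i).threshold_utility_le
      (hF.integrableOn_ironedBuyProb hwn (fun j => (hv j).2) i) c t
  participation i c _ := by
    rw [(hF.interimUtility_ironedMechanism hwn i c c).2]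
    refine integral_nonneg fun v => ?_
    simp only [sub_self, zero_mul, zero_add]
    exact integral_nonneg fun s => (ironedBuyProb_mem hwn.le _ i).1

theorem interimBuyProb_ironedMechanism_eq_zero (hF : HasPositiveDensity μ f a b) (hwn : w < n)
    (i : Fin n) {t : ℝ} (ht : b ≤ t) :
    (ironedMechanism μ f a b hwn.le).interimBuyProb μ i t = 0 := by
  refine integral_eq_zero_of_ae ?_
  filter_upwards [hF.ae_pi_mem] with v hv
  exact hF.ironedBuyProb_eq_zero hwn (fun j => (hv j).2) i ht

/-- The interim payment is again of threshold form, so the one-seller results apply to the interim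
rule. -/
theorem interimPay_ironedMechanism (hF : HasPositiveDensity μ f a b) (hwn : w < n)
    (i : Fin n) (t : ℝ) :
    (ironedMechanism μ f a b hwn.le).interimPay μ i t =
      t * (ironedMechanism μ f a b hwn.le).interimBuyProb μ i t +
        ∫ s in Set.Ioc t b, (ironedMechanism μ f a b hwn.le).interimBuyProb μ i s := by
  have h1 : Integrable (fun v => ironedBuyProb μ f a b hwn.le (Function.update v i t) i)
      (Measure.pi fun _ => μ) := DirectMechanism.integrable_buyProb_update (μ := μ)
    (hF.measurable_buyProb_ironedMechanism hwn.le i) t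
  have h2 : Integrable (fun p : (Fin n → ℝ) × ℝ =>
      ironedBuyProb μ f a b hwn.le (Function.update p.1 i p.2) i)
      ((Measure.pi fun _ => μ).prod (volume.restrict (Set.Ioc t b))) :=
    Integrable.of_bound ((hF.measurable_ironedBuyProb hwn.le i).comp
      measurable_update').aestronglyMeasurable 1 (Eventually.of_forall fun p => by
        rw [Real.norm_eq_abs, abs_of_nonneg (ironedBuyProb_mem hwn.le _ i).1]
        exact (ironedBuyProb_mem hwn.le _ i).2)
  have h3 : (ironedMechanism μ f a b hwn.le).interimPay μ i t =
      ∫ v, (t * ironedBuyProb μ f a b hwn.le (Function.update v i t) i +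
        ∫ s in Set.Ioc t b, ironedBuyProb μ f a b hwn.le (Function.update v i s) i)
        ∂(Measure.pi fun _ => μ) := by
    refine integral_congr_ae ?_
    filter_upwards [hF.ae_pi_mem] with v hv
    rw [ironedMechanism_pay_update, hF.setIntegral_ironedBuyProb hwn fun j => (hv j).2]
  rw [h3, integral_add (h1.const_mul t) h2.integral_prod_left, integral_const_mul,
    integral_integral_swap h2]
  rfl

theorem vanishesAtInfinity_ironedMechanism (hF : HasPositiveDensity μ f a b) (hwn : w < n) :
    (ironedMechanism μ f a b hwn.le).VanishesAtInfinity μ := by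
  intro i
  constructor
  · refine tendsto_const_nhds.congr' ?_
    filter_upwards [eventually_ge_atTop b] with t ht
    exact (hF.interimBuyProb_ironedMechanism_eq_zero hwn i ht).symm
  · refine tendsto_const_nhds.congr' ?_
    filter_upwards [eventually_ge_atTop b] with t ht
    rw [hF.interimPay_ironedMechanism hwn, hF.interimBuyProb_ironedMechanism_eq_zero hwn i ht,
      Set.Ioc_eq_empty (not_lt.2 ht)]
    simp

theorem antitone_interimBuyProb_ironedMechanism (hF : HasPositiveDensity μ f a b) (hwn : w < n)
    (i : Fin n) : Antitone ((ironedMechanism μ f a b hwn.le).interimBuyProb μ i) := by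
  have h := fun t => DirectMechanism.integrable_buyProb_update (μ := μ)
    (hF.measurable_buyProb_ironedMechanism hwn.le i) t
  exact fun s t hst => integral_mono (h t) (h s) fun v =>
    hF.antitone_ironedBuyProb hwn.le v i hst

/-- A report enters the lottery only through its score. This supplies the equality case
`integral_mul_ironedCost_eq`. -/
theorem interimBuyProb_ironedMechanism_congr (hF : HasPositiveDensity μ f a b) (hw : w ≤ n)
    (i : Fin n) {y z : ℝ} (hy : y < b) (hz : z < b)
    (h : ironedCost μ f a b y = ironedCost μ f a b z) :
    (ironedMechanism μ f a b hw).interimBuyProb μ i y =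
      (ironedMechanism μ f a b hw).interimBuyProb μ i z := by
  refine integral_congr_ae (Eventually.of_forall fun v => ?_)
  change ironedBuyProb μ f a b hw (Function.update v i y) i =
    ironedBuyProb μ f a b hw (Function.update v i z) i
  rw [ironedBuyProb_update, ironedBuyProb_update, hF.ironedVirtualCost_of_lt hy,
    hF.ironedVirtualCost_of_lt hz, h]

/-- The expected payment of the ironed mechanism is its expected ironed virtual cost. -/
theorem expectedPayment_ironedMechanism (hF : HasPositiveDensity μ f a b) (hwn : w < n) :
    (ironedMechanism μ f a b hwn.le).expectedPayment μ =
      ∫ v, ∑ i, (ironedMechanism μ f a b hwn.le).buyProb v i * ironedCost μ f a b (v i)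
        ∂(Measure.pi fun _ => μ) := by
  have hm := (hF.isBICProcurement_ironedMechanism hwn).measurable_buyProb
  rw [DirectMechanism.expectedPayment,
    integral_finsetSum _ fun i _ => hF.integrable_ironedMechanism_pay hwn i,
    integral_finsetSum _ fun i _ => (DirectMechanism.integral_buyProb_mul
      (M := ironedMechanism μ f a b hwn.le) (hm i) hF.integrable_ironedCost).1]
  refine Finset.sum_congr rfl fun i _ => ?_
  rw [(integral_pi_eq_integral_update i (hF.integrable_ironedMechanism_pay hwn i)).2,
    (DirectMechanism.integral_buyProb_mul (M := ironedMechanism μ f a b hwn.le) (hm i)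
      hF.integrable_ironedCost).2,
    hF.integral_mul_ironedCost_eq (DirectMechanism.measurable_interimBuyProb (hm i))
      DirectMechanism.interimBuyProb_nonneg (DirectMechanism.interimBuyProb_le_one (hm i))
      ((hF.antitone_interimBuyProb_ironedMechanism hwn i).antitoneOn _)
      fun y z hy hz h => hF.interimBuyProb_ironedMechanism_congr hwn.le i hy hz h]
  exact integral_congr_ae (Eventually.of_forall fun t => hF.interimPay_ironedMechanism hwn i t)

end HasPositiveDensity

/-! ### The envelope inequality and optimality -/

/-- An antitone subgradient of a function integrates to at most its increment. -/
theorem integral_le_of_antitoneOn_subgradient {X U : ℝ → ℝ} {c b : ℝ} (hcb : c ≤ b)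
    (hX : AntitoneOn X (Set.Icc c b))
    (hU : ∀ s ∈ Set.Icc c b, ∀ t ∈ Set.Icc c b, s ≤ t → (t - s) * X t ≤ U s - U t) :
    ∫ s in c..b, X s ≤ U c - U b := by
  have hint : ∀ s ∈ Set.Icc c b, ∀ t ∈ Set.Icc c b, IntervalIntegrable X volume s t :=
    fun s hs t ht => (hX.mono (Set.uIcc_subset_Icc hs ht)).intervalIntegrable
  have hc : c ∈ Set.Icc c b := ⟨le_rfl, hcb⟩
  set D : ℝ → ℝ := fun s => U s + ∫ x in c..s, X x with hD
  -- `D` grows over a step by at most its length times the drop of `X`. Over `N + 1` equal steps the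
  -- drops telescope, so the total growth of `D` is `O(1/N)`; no regularity of `U` is needed.
  have hstep : ∀ s ∈ Set.Icc c b, ∀ t ∈ Set.Icc c b, s ≤ t →
      D t - D s ≤ (t - s) * (X s - X t) := by
    intro s hs t ht hst
    have h1 : ∫ x in s..t, X x ≤ ∫ _ in s..t, X s :=
      intervalIntegral.integral_mono_on hst (hint s hs t ht) intervalIntegrable_const
        fun x hx => hX hs ⟨hs.1.trans hx.1, hx.2.trans ht.2⟩ hx.1
    rw [intervalIntegral.integral_const, smul_eq_mul] at h1
    have h2 := intervalIntegral.integral_add_adjacent_intervals (hint c hc s hs) (hint s hs t ht)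
    have h3 := hU s hs t ht hst
    simp only [hD]
    linarith
  have hN : ∀ N : ℕ, D b - D c ≤ (b - c) * (X c - X b) / (N + 1 : ℕ) := by
    intro N
    have hpos : (0 : ℝ) < (N + 1 : ℕ) := by positivity
    set δ := (b - c) / (N + 1 : ℕ) with hδ
    have hδ0 : 0 ≤ δ := div_nonneg (sub_nonneg.2 hcb) hpos.le
    have hδN : (N + 1 : ℕ) * δ = b - c := mul_div_cancel₀ _ hpos.ne'
    have hmem : ∀ k ≤ N + 1, c + k * δ ∈ Set.Icc c b := by
      intro k hk
      have h1 : (k : ℝ) * δ ≤ (N + 1 : ℕ) * δ :=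
        mul_le_mul_of_nonneg_right (by exact_mod_cast hk) hδ0
      have h2 : 0 ≤ (k : ℝ) * δ := by positivity
      constructor <;> linarith
    have hsum : ∑ k ∈ Finset.range (N + 1), (D (c + (k + 1 : ℕ) * δ) - D (c + k * δ)) ≤
        ∑ k ∈ Finset.range (N + 1), δ * (X (c + k * δ) - X (c + (k + 1 : ℕ) * δ)) := by
      refine Finset.sum_le_sum fun k hk => ?_
      have hk' := Finset.mem_range.1 hk
      have h := hstep _ (hmem k hk'.le) _ (hmem (k + 1) hk') (by push_cast; linarith)
      have hdiff : c + (k + 1 : ℕ) * δ - (c + k * δ) = δ := by push_cast; ring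
      rwa [hdiff] at h
    rw [Finset.sum_range_sub (fun k : ℕ => D (c + k * δ)), ← Finset.mul_sum,
      Finset.sum_range_sub' (fun k : ℕ => X (c + k * δ)), hδN] at hsum
    simp only [Nat.cast_zero, zero_mul, add_zero, add_sub_cancel] at hsum
    rwa [hδ, div_mul_eq_mul_div] at hsum
  have hlim := (tendsto_const_div_atTop_nhds_zero_nat ((b - c) * (X c - X b))).comp
    (tendsto_add_atTop_nat 1)
  have h := ge_of_tendsto' hlim hN
  simp only [hD, intervalIntegral.integral_same] at h
  linarith

namespace DirectMechanism

variable {n w : ℕ} {μ : Measure ℝ} {M : DirectMechanism n} {a b : ℝ}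

namespace IsBICProcurement

/-- Adding the two truthfulness constraints between `s` and `t` cancels the payments and leaves `(t
- s)(x(s) - x(t)) ≥ 0`. -/
theorem antitoneOn_interimBuyProb (hM : M.IsBICProcurement μ w (Set.Icc a b)) (i : Fin n) :
    AntitoneOn (M.interimBuyProb μ i) (Set.Icc a b) := by
  intro s hs t ht hst
  rcases eq_or_lt_of_le hst with rfl | hlt
  · exact le_rfl
  have h1 := hM.truthful i s hs t
  have h2 := hM.truthful i t ht s
  simp only [interimUtility] at h1 h2
  by_contra h
  nlinarith [mul_pos (sub_pos.2 hlt) (sub_pos.2 (not_le.1 h))]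

/-- Truthfulness makes the purchase probability a subgradient of the utility, up to sign.
Participation at the worst cost `b` fixes the constant of integration; only an inequality is needed.
-/
theorem le_interimPay (hM : M.IsBICProcurement μ w (Set.Icc a b)) (i : Fin n) {c : ℝ}
    (hc : c ∈ Set.Icc a b) :
    c * M.interimBuyProb μ i c + ∫ s in Set.Ioc c b, M.interimBuyProb μ i s ≤
      M.interimPay μ i c := by
  have hsub : Set.Icc c b ⊆ Set.Icc a b := Set.Icc_subset_Icc hc.1 le_rfl
  have h := integral_le_of_antitoneOn_subgradient (U := fun s => M.interimUtility μ i s s) hc.2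
    ((hM.antitoneOn_interimBuyProb i).mono hsub) fun s hs t _ _ => by
      have := hM.truthful i s (hsub hs) t
      simp only [interimUtility] at this ⊢
      linarith
  have hb := hM.participation i b ⟨hc.1.trans hc.2, le_rfl⟩
  rw [intervalIntegral.integral_of_le hc.2] at h
  simp only [interimUtility] at h hb
  linarith

/-- The expected payment of a BIC mechanism is at least its expected ironed virtual cost. -/
theorem le_expectedPayment [IsProbabilityMeasure μ] {f : ℝ → ℝ} (hF : HasPositiveDensity μ f a b)
    (hM : M.IsBICProcurement μ w (Set.Icc a b)) :
    ∫ v, ∑ i, M.buyProb v i * ironedCost μ f a b (v i) ∂(Measure.pi fun _ => μ) ≤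
      M.expectedPayment μ := by
  have hm := hM.measurable_buyProb
  rw [expectedPayment, integral_finsetSum _ fun i _ => hM.integrable_pay i,
    integral_finsetSum _ fun i _ => (integral_buyProb_mul (hm i) hF.integrable_ironedCost).1]
  refine Finset.sum_le_sum fun i _ => ?_
  obtain ⟨h1, h2⟩ := integral_pi_eq_integral_update i (hM.integrable_pay i)
  have h0 := interimBuyProb_nonneg (μ := μ) (M := M) (i := i)
  have h1' := interimBuyProb_le_one (μ := μ) (hm i)
  rw [h2, (integral_buyProb_mul (hm i) hF.integrable_ironedCost).2]
  refine (hF.integral_mul_ironedCost_le (measurable_interimBuyProb (hm i)) h0 h1'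
    (hM.antitoneOn_interimBuyProb i)).trans ?_
  refine integral_mono_ae (hF.integral_payment (C := 1) (measurable_interimBuyProb (hm i))
    fun z _ => by rw [abs_of_nonneg (h0 z)]; exact h1' z).1 h1 ?_
  filter_upwards [hF.ae_mem] with c hc
  exact hM.le_interimPay i ⟨hc.1, hc.2.le⟩

end IsBICProcurement

end DirectMechanism

namespace HasPositiveDensity

variable {μ : Measure ℝ} [IsProbabilityMeasure μ] {f : ℝ → ℝ} {a b : ℝ} {n w : ℕ}

theorem mem_cheapestSets_ironedCost (hF : HasPositiveDensity μ f a b) (hw : w ≤ n)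
    {v : Fin n → ℝ} (hv : ∀ j, v j < b) {W : Finset (Fin n)}
    (hW : W ∈ ((ironedMechanism μ f a b hw).alloc v).support) :
    W ∈ cheapestSets w fun i => (ironedCost μ f a b (v i) : EReal) := by
  have h := mem_support_cheapestLottery (hw := hw).1 hW
  simp only [fun i => hF.ironedVirtualCost_of_lt (hv i)] at h
  exact h

/-- Both payments are replaced by expected ironed virtual costs, exactly on the left and as a lower
bound on the right, and these compare profile by profile. -/
theorem expectedPayment_ironedMechanism_le (hF : HasPositiveDensity μ f a b) (hwn : w < n)
    {M : DirectMechanism n} (hM : M.IsBICProcurement μ w (Set.Icc a b)) :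
    (ironedMechanism μ f a b hwn.le).expectedPayment μ ≤ M.expectedPayment μ := by
  rw [hF.expectedPayment_ironedMechanism hwn]
  refine le_trans ?_ (hM.le_expectedPayment hF)
  have hγ := hF.integrable_ironedCost
  refine integral_mono_ae
    (integrable_finsetSum _ fun i _ => (DirectMechanism.integral_buyProb_mul
      (hF.measurable_buyProb_ironedMechanism hwn.le i) hγ).1)
    (integrable_finsetSum _ fun i _ => (DirectMechanism.integral_buyProb_mul
      (hM.measurable_buyProb i) hγ).1) ?_
  filter_upwards [hF.ae_pi_mem] with v hv
  exact sum_inclusionProb_mul_le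
    (fun W hW => hF.mem_cheapestSets_ironedCost hwn.le (fun j => (hv j).2) hW)
    (hM.buys v fun j => ⟨(hv j).1, (hv j).2.le⟩)

/-! ### Comparison with the ironed revenue curve -/

theorem ironedCost_mono (hF : HasPositiveDensity μ f a b) {y z : ℝ} (hyz : y ≤ z) (hz : z < b) :
    ironedCost μ f a b y ≤ ironedCost μ f a b z := by
  have h := hF.monotone_ironedVirtualCost hyz
  rwa [hF.ironedVirtualCost_of_lt hz, hF.ironedVirtualCost_of_lt (hyz.trans_lt hz),
    EReal.coe_le_coe_iff] at h

theorem integral_indicator_ironedCost_sub (hF : HasPositiveDensity μ f a b) {α : ℝ}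
    (hα : α ∈ Set.Icc a b) (κ : ℝ) :
    ∫ z, (Set.Iic α).indicator (fun z => ironedCost μ f a b z - κ) z ∂μ =
      ironedCumulative μ f a b (cdf μ α) - cdf μ α * κ := by
  have hγ := hF.integrable_ironedCost
  rw [integral_indicator measurableSet_Iic, integral_sub hγ.integrableOn (integrable_const κ),
    setIntegral_const, ← ProbabilityTheory.cdf_eq_real, smul_eq_mul,
    ← integral_indicator measurableSet_Iic, hF.integral_eq,
    ← hF.setIntegral_density_mul_ironedCost hα]
  congr 1
  have h1 : ∀ z, f z * (Set.Iic α).indicator (ironedCost μ f a b) z =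
      (Set.Iic α).indicator (fun z => f z * ironedCost μ f a b z) z := by
    intro z
    by_cases h : z ∈ Set.Iic α
    · rw [Set.indicator_of_mem h, Set.indicator_of_mem h]
    · rw [Set.indicator_of_notMem h, Set.indicator_of_notMem h, mul_zero]
  simp_rw [h1]
  rw [setIntegral_indicator measurableSet_Iic]
  congr 2
  ext s; simp only [Set.mem_inter_iff, Set.mem_Icc, Set.mem_Iic]
  exact ⟨fun h => ⟨h.1.1, h.2⟩, fun h => ⟨⟨h.1, h.2.trans hα.2⟩, h.2⟩⟩

/-- Buying `w` units in expectation is no more expensive than always buying `w` units. -/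
theorem mul_ironedCumulative_le (hF : HasPositiveDensity μ f a b) (hwn : w < n) :
    n * ironedCumulative μ f a b (w / n) ≤
      (ironedMechanism μ f a b hwn.le).expectedPayment μ := by
  have hn : (0 : ℝ) < n := by exact_mod_cast (Nat.zero_le w).trans_lt hwn
  have hq : (w / n : ℝ) ∈ Set.Icc (0 : ℝ) 1 :=
    ⟨by positivity, (div_le_one hn).2 (by exact_mod_cast hwn.le)⟩
  have hq1 : (w / n : ℝ) < 1 := (div_lt_one hn).2 (by exact_mod_cast hwn)
  set α := quantile μ a b (w / n) with hα
  have hαm : α ∈ Set.Icc a b := hF.quantile_mem hq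
  have hFα : cdf μ α = w / n := hF.cdf_quantile hq
  have hαb : α < b := by
    by_contra h
    rw [hF.cdf_of_ge (not_lt.1 h)] at hFα
    linarith
  -- `κ` is the Lagrange multiplier of the constraint that the purchase probabilities add up to `w`.
  set κ := ironedCost μ f a b α with hκ
  have hγ := hF.integrable_ironedCost
  have hind : Integrable ((Set.Iic α).indicator (fun z => ironedCost μ f a b z - κ)) μ :=
    (hγ.sub (integrable_const κ)).indicator measurableSet_Iic
  have hindi : ∀ i : Fin n, Integrable (fun v : Fin n → ℝ =>
      (Set.Iic α).indicator (fun z => ironedCost μ f a b z - κ) (v i)) (Measure.pi fun _ => μ) :=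
    fun i => (measurePreserving_eval (fun _ : Fin n => μ) i).integrable_comp_of_integrable hind
  have hlow : ∫ v : Fin n → ℝ, ((∑ i, (Set.Iic α).indicator
      (fun z => ironedCost μ f a b z - κ) (v i)) + w * κ) ∂(Measure.pi fun _ => μ) =
      n * ironedCumulative μ f a b (w / n) := by
    rw [integral_add (integrable_finsetSum _ fun i _ => hindi i) (integrable_const _),
      integral_finsetSum _ fun i _ => hindi i]
    simp_rw [integral_comp_eval (μ := fun _ : Fin n => μ) hind.aestronglyMeasurable]
    rw [Finset.sum_const, Finset.card_univ, Fintype.card_fin, nsmul_eq_mul,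
      hF.integral_indicator_ironedCost_sub hαm, hFα, integral_const, probReal_univ, one_smul]
    field_simp
    ring
  rw [← hlow, hF.expectedPayment_ironedMechanism hwn]
  refine integral_mono_ae ((integrable_finsetSum _ fun i _ => hindi i).add (integrable_const _))
    (integrable_finsetSum _ fun i _ => (DirectMechanism.integral_buyProb_mul
      (hF.measurable_buyProb_ironedMechanism hwn.le i) hγ).1) ?_
  filter_upwards [hF.ae_pi_mem] with v hv
  have hsum : ∑ i, (ironedMechanism μ f a b hwn.le).buyProb v i = w :=
    sum_inclusionProb fun W hW =>
      (hF.isBICProcurement_ironedMechanism hwn).buys v (fun _ => Set.mem_univ _) W hW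
  rw [← hsum, Finset.sum_mul, ← Finset.sum_add_distrib]
  refine Finset.sum_le_sum fun i _ => ?_
  have h0 := (ironedMechanism μ f a b hwn.le).buyProb_nonneg v i
  have h1 := (ironedMechanism μ f a b hwn.le).buyProb_le_one v i
  -- Seller by seller, `x (γ - κ) ≥ min (γ - κ) 0` for `x ∈ [0, 1]`, and by monotonicity `γ ≤ κ` up
  -- to `α` and `γ ≥ κ` beyond.
  by_cases h : v i ≤ α
  · rw [Set.indicator_of_mem (Set.mem_Iic.2 h)]
    have h2 : ironedCost μ f a b (v i) ≤ κ := hF.ironedCost_mono h hαb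
    nlinarith [mul_nonneg (sub_nonneg.2 h1) (sub_nonneg.2 h2)]
  · rw [Set.indicator_of_notMem (s := Set.Iic α) h, zero_add]
    exact mul_le_mul_of_nonneg_left (hF.ironedCost_mono (not_le.1 h).le (hv i).2) h0

/-- A quantile at which the hull is strict lies in one of the ironed intervals. -/
theorem exists_ironedInterval (hF : HasPositiveDensity μ f a b) {q : ℝ}
    (hq : q ∈ ironedQuantiles μ f a b) :
    ∃ y z : ℝ, 0 ≤ y ∧ z ≤ 1 ∧ q ∈ Set.Ioo y z ∧ Set.Ioo y z ⊆ ironedQuantiles μ f a b ∧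
      y ∉ ironedQuantiles μ f a b ∧ z ∉ ironedQuantiles μ f a b := by
  have hH := hF.cumulativeVirtualCost_nonneg
  have hH0 : cumulativeVirtualCost μ f a b 0 = 0 := cumulativeVirtualCost_zero
  have hHc := hF.continuousOn_cumulativeVirtualCost
  have hdiff : ContinuousOn (fun p => cumulativeVirtualCost μ f a b p -
      ironedCumulative μ f a b p) (Set.Icc 0 1) :=
    hHc.sub (continuousOn_lowerConvexHull hH hH0 hHc)
  have hcomp : ∀ c d : ℝ, 0 ≤ c → d ≤ 1 → IsCompact (Set.Icc c d ∩
      (fun p => cumulativeVirtualCost μ f a b p - ironedCumulative μ f a b p) ⁻¹' {0}) :=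
    fun c d hc hd => isCompact_Icc.of_isClosed_subset
      ((hdiff.mono (Set.Icc_subset_Icc hc hd)).preimage_isClosed_of_isClosed isClosed_Icc
        isClosed_singleton) Set.inter_subset_left
  -- `y` is the last zero of `H - G` up to `q` and `z` the first one from `q` on; there are zeros at
  -- `0` and `1`.
  obtain ⟨y, hy, hymax⟩ := (hcomp 0 q le_rfl hq.1.2).exists_isGreatest
    ⟨0, ⟨le_rfl, hq.1.1⟩, sub_eq_zero.2 (hH0.trans (lowerConvexHull_zero hH hH0).symm)⟩
  obtain ⟨z, hz, hzmin⟩ := (hcomp q 1 hq.1.1 le_rfl).exists_isLeast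
    ⟨1, ⟨hq.1.2, le_rfl⟩, sub_eq_zero.2 (lowerConvexHull_one hH hHc).symm⟩
  have hyq : y ≠ q := fun h => hq.2 (h ▸ sub_eq_zero.1 hy.2)
  have hzq : z ≠ q := fun h => hq.2 (h ▸ sub_eq_zero.1 hz.2)
  refine ⟨y, z, hy.1.1, hz.1.2, ⟨lt_of_le_of_ne hy.1.2 hyq, lt_of_le_of_ne hz.1.1 hzq.symm⟩,
    fun p hp => ?_, fun h => h.2 (sub_eq_zero.1 hy.2), fun h => h.2 (sub_eq_zero.1 hz.2)⟩
  have hp0 : 0 ≤ p := hy.1.1.trans hp.1.le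
  have hp1 : p ≤ 1 := hp.2.le.trans hz.1.2
  refine ⟨⟨hp0, hp1⟩, fun h => ?_⟩
  rcases le_total p q with hpq | hpq
  · exact absurd (hymax ⟨⟨hp0, hpq⟩, sub_eq_zero.2 h⟩) (not_le.2 hp.1)
  · exact absurd (hzmin ⟨⟨hpq, hp1⟩, sub_eq_zero.2 h⟩) (not_le.2 hp.2)

/-- On an ironed interval `G` interpolates linearly between `y l` and `z u`. Both values lie above
the line `q ↦ q u/r`, and `H(q) = q F⁻¹(q) ≤ q u`. -/
theorem mul_quantile_le_ironedCumulative (hF : HasPositiveDensity μ f a b) {r : ℝ} (hr : 1 < r)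
    (hI : ∀ l u : ℝ, IsIronedInterval μ f a b l u → u / r ≤ l) {q : ℝ}
    (hq : q ∈ Set.Icc (0 : ℝ) 1) :
    q * quantile μ a b q ≤ r * ironedCumulative μ f a b q := by
  have hr0 : 0 < r := zero_lt_one.trans hr
  have hH := hF.cumulativeVirtualCost_nonneg
  have hH0 : cumulativeVirtualCost μ f a b 0 = 0 := cumulativeVirtualCost_zero
  have hHc := hF.continuousOn_cumulativeVirtualCost
  by_cases hqI : q ∈ ironedQuantiles μ f a b
  · obtain ⟨y, z, hy, hz, hqyz, hsub, hyI, hzI⟩ := hF.exists_ironedInterval hqI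
    have hym : y ∈ Set.Icc (0 : ℝ) 1 := ⟨hy, hqyz.1.le.trans hq.2⟩
    have hzm : z ∈ Set.Icc (0 : ℝ) 1 := ⟨hq.1.trans hqyz.2.le, hz⟩
    have hl := hI _ _ ⟨y, z, hqyz.1.trans hqyz.2, hsub, hyI, hzI, rfl, rfl⟩
    have hyG : ironedCumulative μ f a b y = y * quantile μ a b y := by
      rw [← hF.cumulativeVirtualCost_eq hym]
      by_contra h
      exact hyI ⟨hym, fun h' => h h'.symm⟩
    have hzG : ironedCumulative μ f a b z = z * quantile μ a b z := by
      rw [← hF.cumulativeVirtualCost_eq hzm]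
      by_contra h
      exact hzI ⟨hzm, fun h' => h h'.symm⟩
    obtain ⟨h1, h2⟩ := lowerConvexHull_eq_of_Ioo hH hH0 hHc hy hz (fun p hp => (hsub hp).2) hqyz
    change ironedCumulative μ f a b q = ironedCumulative μ f a b y + _ at h1
    change ironedCumulative μ f a b z = ironedCumulative μ f a b q + _ at h2
    set κ := hullSlope (cumulativeVirtualCost μ f a b) q
    set u := quantile μ a b z with hu
    have hu0 : 0 ≤ u := hF.nonneg.trans (hF.quantile_mem hzm).1
    have hqu : quantile μ a b q ≤ u := hF.monotoneOn_quantile hq hzm hqyz.2.le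
    have hur : u / r ≤ u := div_le_self hu0 hr.le
    have hA : y * (u / r) ≤ ironedCumulative μ f a b y := by
      rw [hyG]; exact mul_le_mul_of_nonneg_left hl hy
    have hB : z * (u / r) ≤ ironedCumulative μ f a b z := by
      rw [hzG]; exact mul_le_mul_of_nonneg_left hur hzm.1
    have hmain : q * (u / r) ≤ ironedCumulative μ f a b q := by
      have h3 := mul_le_mul_of_nonneg_left hA (sub_nonneg.2 hqyz.2.le)
      have h4 := mul_le_mul_of_nonneg_left hB (sub_nonneg.2 hqyz.1.le)
      refine le_of_mul_le_mul_left ?_ (sub_pos.2 (hqyz.1.trans hqyz.2))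
      have h5 : (z - y) * ironedCumulative μ f a b q =
          (z - q) * ironedCumulative μ f a b y + (q - y) * ironedCumulative μ f a b z := by
        rw [h2]
        linear_combination (z - q) * h1
      rw [h5]
      linarith
    calc q * quantile μ a b q ≤ q * u := mul_le_mul_of_nonneg_left hqu hq.1
      _ = r * (q * (u / r)) := by field_simp
      _ ≤ r * ironedCumulative μ f a b q := mul_le_mul_of_nonneg_left hmain hr0.le
  · have hqG : ironedCumulative μ f a b q = q * quantile μ a b q := by
      rw [← hF.cumulativeVirtualCost_eq hq]
      by_contra h
      exact hqI ⟨hq, fun h' => h h'.symm⟩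
    rw [← hqG]
    exact le_mul_of_one_le_left (lowerConvexHull_nonneg hH hq) hr.le

end HasPositiveDensity

/-! ### The posted-price mechanism -/

theorem integrable_comp_abs {g : ℝ → ℝ} (hg : IntegrableOn g (Set.Ioi 0)) :
    Integrable fun x => g |x| := by
  have h1 : IntegrableOn (fun x => g |x|) (Set.Ioi 0) :=
    hg.congr_fun (fun x hx => by rw [abs_of_pos hx]) measurableSet_Ioi
  have h2 : IntegrableOn (fun x => g |x|) (Set.Iio 0) := by
    have := (Measure.measurePreserving_neg (volume : Measure ℝ)).integrableOn_comp_preimage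
      (MeasurableEquiv.neg ℝ).measurableEmbedding (f := fun x => g |x|) (s := Set.Ioi 0)
    have h3 := this.2 h1
    simpa [Function.comp_def] using h3
  rw [← integrableOn_univ, ← Set.Iic_union_Ioi (a := (0 : ℝ))]
  exact ((integrableOn_Iic_iff_integrableOn_Iio).2 h2).union h1

/-! ### The Laplace law: total mass and mean -/

section Laplace

variable {s : ℝ}

theorem integral_laplace_density (hs : 0 < s) :
    Integrable (fun x : ℝ => Real.exp (-|x| / s) / (2 * s)) ∧
      ∫ x : ℝ, Real.exp (-|x| / s) / (2 * s) = 1 := by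
  have hneg : -(1 / s) < 0 := by simpa using hs
  have h1 : ∀ x : ℝ, Real.exp (-x / s) = Real.exp (-(1 / s) * x) := fun x => by
    congr 1; field_simp
  have h2 : IntegrableOn (fun x : ℝ => Real.exp (-x / s) / (2 * s)) (Set.Ioi 0) := by
    simp_rw [h1]
    exact (integrableOn_exp_mul_Ioi hneg 0).div_const _
  refine ⟨integrable_comp_abs h2, ?_⟩
  rw [integral_comp_abs (f := fun x => Real.exp (-x / s) / (2 * s))]
  simp_rw [h1]
  rw [integral_div, integral_exp_mul_Ioi hneg]
  simp only [mul_zero, Real.exp_zero]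
  field_simp

theorem isProbabilityMeasure_laplaceLaw (hs : 0 ≤ s) : IsProbabilityMeasure (laplaceLaw s) := by
  rw [laplaceLaw]
  split_ifs with h
  · infer_instance
  · have hs' : 0 < s := lt_of_le_of_ne hs (Ne.symm h)
    obtain ⟨h1, h2⟩ := integral_laplace_density hs'
    refine ⟨?_⟩
    rw [withDensity_apply _ MeasurableSet.univ, Measure.restrict_univ,
      ← ofReal_integral_eq_lintegral_ofReal h1 (Eventually.of_forall fun x => by positivity), h2,
      ENNReal.ofReal_one]

theorem integral_laplaceLaw (hs : 0 ≤ s) :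
    Integrable (fun x => x) (laplaceLaw s) ∧ ∫ x, x ∂(laplaceLaw s) = 0 := by
  rw [laplaceLaw]
  split_ifs with h
  · exact ⟨integrable_dirac (by simp), by simp⟩
  · have hs' : 0 < s := lt_of_le_of_ne hs (Ne.symm h)
    have hmeas : Measurable fun x : ℝ => ENNReal.ofReal (Real.exp (-|x| / s) / (2 * s)) := by
      fun_prop
    have hden : ∀ x : ℝ, 0 ≤ Real.exp (-|x| / s) / (2 * s) := fun x => by positivity
    constructor
    · rw [integrable_withDensity_iff_integrable_smul' hmeas (by simp)]
      simp only [smul_eq_mul, ENNReal.toReal_ofReal (hden _)]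
      have h1 : IntegrableOn (fun x : ℝ => Real.exp (-x / s) / (2 * s) * x) (Set.Ioi 0) := by
        have h2 := integrableOn_rpow_mul_exp_neg_mul_rpow (p := 1) (s := 1) (b := 1 / s)
          (by norm_num) one_pos (by positivity)
        refine IntegrableOn.congr_fun (h2.div_const (2 * s)) (fun x _ => ?_) measurableSet_Ioi
        have h3 : -(1 / s) * x = -x / s := by field_simp
        simp only [Real.rpow_one, h3]
        ring
      refine (integrable_comp_abs h1).mono (by fun_prop) (Eventually.of_forall fun x => ?_)
      simp
    · rw [integral_withDensity_eq_integral_toReal_smul hmeas (by simp)]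
      simp only [smul_eq_mul, ENNReal.toReal_ofReal (hden _)]
      -- The integrand is odd, so its integral equals its own negative.
      have h1 := integral_neg_eq_self (fun x : ℝ => Real.exp (-|x| / s) / (2 * s) * x) volume
      simp only [abs_neg, mul_neg, integral_neg] at h1
      linarith

end Laplace

/-- Acceptance depends on the cost alone, so independence factors the expectation and the centred
noise drops out. -/
theorem noisyPostedPricePayment_eq {μ : Measure ℝ} [IsProbabilityMeasure μ] (n : ℕ) (α : ℝ) {s : ℝ}
    (hs : 0 ≤ s) : noisyPostedPricePayment μ n α s = n * (cdf μ α * α) := by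
  have := isProbabilityMeasure_laplaceLaw hs
  obtain ⟨hL, hL0⟩ := integral_laplaceLaw hs
  have hu : Integrable ((Set.Iic α).indicator fun _ => (1 : ℝ)) μ :=
    (integrable_const 1).indicator measurableSet_Iic
  have hv : Integrable (fun x => α + x) (laplaceLaw s) := (integrable_const α).add hL
  have hterm : ∀ (i : Fin n) (ω : (Fin n → ℝ) × (Fin n → ℝ)),
      (if ω.1 i ≤ α then α + ω.2 i else 0) =
        (Set.Iic α).indicator (fun _ => (1 : ℝ)) (ω.1 i) * (α + ω.2 i) := by
    intro i ω
    by_cases h : ω.1 i ≤ α <;> simp [h]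
  have hint : ∀ i : Fin n, Integrable (fun ω : (Fin n → ℝ) × (Fin n → ℝ) =>
      (Set.Iic α).indicator (fun _ => (1 : ℝ)) (ω.1 i) * (α + ω.2 i))
      ((Measure.pi fun _ => μ).prod (Measure.pi fun _ => laplaceLaw s)) := fun i =>
    Integrable.mul_prod
      ((measurePreserving_eval (fun _ : Fin n => μ) i).integrable_comp_of_integrable hu)
      ((measurePreserving_eval (fun _ : Fin n => laplaceLaw s) i).integrable_comp_of_integrable hv)
  rw [noisyPostedPricePayment]
  simp_rw [hterm]
  rw [integral_finsetSum _ fun i _ => hint i]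
  have hone : ∀ i : Fin n, ∫ ω : (Fin n → ℝ) × (Fin n → ℝ),
      (Set.Iic α).indicator (fun _ => (1 : ℝ)) (ω.1 i) * (α + ω.2 i)
      ∂((Measure.pi fun _ => μ).prod (Measure.pi fun _ => laplaceLaw s)) = cdf μ α * α := by
    intro i
    rw [integral_prod_mul (fun v : Fin n → ℝ => (Set.Iic α).indicator (fun _ => (1 : ℝ)) (v i))
      (fun v : Fin n → ℝ => α + v i),
      integral_comp_eval (μ := fun _ : Fin n => μ) hu.aestronglyMeasurable,
      integral_comp_eval (μ := fun _ : Fin n => laplaceLaw s) hv.aestronglyMeasurable,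
      integral_indicator_const _ measurableSet_Iic, ← ProbabilityTheory.cdf_eq_real,
      integral_add (integrable_const α) hL, hL0]
    simp
  simp [hone]

theorem HasPositiveDensity.noisyPostedPricePayment_le {μ : Measure ℝ} [IsProbabilityMeasure μ]
    {f : ℝ → ℝ} {a b : ℝ} (hF : HasPositiveDensity μ f a b) {n w : ℕ} (hwn : w < n) {r : ℝ}
    (hr : 1 < r) (hI : ∀ l u : ℝ, IsIronedInterval μ f a b l u → u / r ≤ l) {s : ℝ} (hs : 0 ≤ s) :
    noisyPostedPricePayment μ n (quantile μ a b ((w : ℝ) / (n : ℝ))) s ≤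
      2 * r * (ironedMechanism μ f a b hwn.le).expectedPayment μ := by
  have hn : (0 : ℝ) < n := by exact_mod_cast (Nat.zero_le w).trans_lt hwn
  have hq : (w / n : ℝ) ∈ Set.Icc (0 : ℝ) 1 :=
    ⟨by positivity, (div_le_one hn).2 (by exact_mod_cast hwn.le)⟩
  have hr0 : 0 < r := zero_lt_one.trans hr
  have h1 := hF.mul_ironedCumulative_le hwn
  have h2 := mul_le_mul_of_nonneg_left (hF.mul_quantile_le_ironedCumulative hr hI hq) hn.le
  have h3 : 0 ≤ n * ironedCumulative μ f a b (w / n) :=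
    mul_nonneg hn.le (lowerConvexHull_nonneg hF.cumulativeVirtualCost_nonneg hq)
  rw [noisyPostedPricePayment_eq n _ hs, hF.cdf_quantile hq]
  have h4 := mul_le_mul_of_nonneg_left h1 hr0.le
  -- The bound with factor `r` is complete; nonnegativity of the optimum relaxes it to `2r`.
  have h5 := mul_nonneg hr0.le (h3.trans h1)
  linarith

end Procurement

/-- Optimality of buying at the lowest ironed virtual costs, and the `2r`-approximation of that
optimum by the private posted-price mechanism that buys `w` units in expectation. -/
theorem mainTheorem6 (μ : Measure ℝ) [IsProbabilityMeasure μ] (f : ℝ → ℝ) (a b : ℝ)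
    (hF : Procurement.HasPositiveDensity μ f a b) (n w : ℕ) (hw : 0 < w) (hwn : w < n) :
    -- buying at the lowest ironed virtual costs is a BIC procurement mechanism
    ((Procurement.ironedMechanism μ f a b hwn.le).IsBICProcurement μ w Set.univ ∧
      (Procurement.ironedMechanism μ f a b hwn.le).VanishesAtInfinity μ) ∧
    -- it has the smallest expected payment among all of them
    (∀ M : Procurement.DirectMechanism n, M.IsBICProcurement μ w (Set.Icc a b) →
      (Procurement.ironedMechanism μ f a b hwn.le).expectedPayment μ ≤ M.expectedPayment μ) ∧
    -- the posted-price mechanism is within a factor `2r` of it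
    (∀ r : ℝ, 1 < r →
      (∀ l u : ℝ, Procurement.IsIronedInterval μ f a b l u → u / r ≤ l) →
      ∀ s : ℝ, 0 ≤ s →
        Procurement.noisyPostedPricePayment μ n
            (Procurement.quantile μ a b ((w : ℝ) / (n : ℝ))) s ≤
          2 * r * (Procurement.ironedMechanism μ f a b hwn.le).expectedPayment μ) := by
  exact ⟨⟨hF.isBICProcurement_ironedMechanism hwn, hF.vanishesAtInfinity_ironedMechanism hwn⟩,
    fun _ hM => hF.expectedPayment_ironedMechanism_le hwn hM,
    fun _ hr hI _ hs => hF.noisyPostedPricePayment_le hwn hr hI hs⟩
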